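/- Let $n\ge 2$, let $A=\{a_1,\dots,a_n\}$ and let $A^*$ be the free monoid on $A$. The polycyclic monoid $P_n$ is the monoid with zero presented by generators $a_1,\dots,a_n,a_1^{-1},\dots,a_n^{-1}$ and relations $a_i^{-1}a_i=1$ and $a_i^{-1}a_j=0$ for $i\ne j$. A (reverse) definite language is a set $X\cup YA^*\subseteq A^*$ with $X,Y\subseteq A^*$ finite. A bijection $\alpha\colon L_1\to L_2$ between definite languages is called permissible if there are partitions $L_1=X_1\sqcup R_1$ and $L_2=X_2\sqcup R_2$, with $X_1,X_2$ finite and $R_1,R_2$ finitely generated (possibly empty) right ideals of $A^*$, such that $\alpha(X_1)=X_2$, $\alpha(R_1)=R_2$, and $\alpha(xy)=\alpha(x)y$ for all $x\in R_1$ and $y\in A^*$; that is, if $\alpha$ is the disjoint union of a bijection between finite languages and an isomorphism between finitely generated right ideals. The Cuntz–Toeplitz monoid $CT(A^*)$ is the set of all permissible bijections between definite languages, under composition of partial maps. An inverse semigroup with zero, ordered by its natural partial order, is distributive if any two compatible elements $s,t$ (meaning that $s^{-1}t$ and $st^{-1}$ are idempotents) have a join and multiplication distributes over such joins on both sides; it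 is Boolean if, moreover, its idempotents form a generalized Boolean algebra. Homomorphisms preserve zero, and a morphism of distributive inverse semigroups is a homomorphism that preserves joins of compatible pairs. A Booleanization of an inverse semigroup with zero $S$ is a Boolean inverse semigroup $B$ with an embedding $\beta\colon S\to B$ such that for every homomorphism $\theta\colon S\to T$ to a Boolean inverse semigroup $T$ there is a unique morphism $\gamma\colon B\to T$ with $\gamma(\beta(s))=\theta(s)$ for all $s\in S$. Theorem. $P_n$ is an inverse monoid, $CT(A^*)$ is a Boolean inverse monoid, and $CT(A^*)$ is the Booleanization of $P_n$, by way of the monoid embedding $\beta\colon P_n\to CT(A^*)$ that sends $a_i$ to the map $A^*\to a_iA^*$, $x\mapsto a_ix$, and $a_i^{-1}$ to its inverse $a_iA^*\to A^*$, $a_ix\mapsto x$. -/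

import Mathlib

universe w

namespace InvSemi

/-! ### Inverse semigroups with zero -/

section Abstract

variable {S : Type*} [SemigroupWithZero S]

/-- `t` is an inverse of `s` (in the sense of semigroup theory). -/
def IsInverseOf (s t : S) : Prop := s * t * s = s ∧ t * s * t = t

variable (S) in
/-- A semigroup (with zero) is inverse if each element has exactly one inverse. -/
def IsInverseSemigroup : Prop := ∀ s : S, ∃! t : S, IsInverseOf s t

/-- The natural partial order: `s ≤ t` iff `s = te` for some idempotent `e`. -/
def NatLE (s t : S) : Prop := ∃ e : S, IsIdempotentElem e ∧ s = t * e

/-- The compatibility relation: `s⁻¹t` and `st⁻¹` are both idempotents. -/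
def Compatible (s t : S) : Prop :=
  ∃ s' t' : S, IsInverseOf s s' ∧ IsInverseOf t t' ∧
    IsIdempotentElem (s' * t) ∧ IsIdempotentElem (s * t')

/-- `j` is the join (least upper bound) of `s` and `t` in the natural partial order. -/
def IsJoin (s t j : S) : Prop :=
  NatLE s j ∧ NatLE t j ∧ ∀ k : S, NatLE s k → NatLE t k → NatLE j k

variable (S) in
/-- Distributive inverse semigroups: compatible pairs have joins, and multiplication distributes
over these joins on both sides. -/
structure IsDistributiveInverse : Prop where
  inverse : IsInverseSemigroup S
  exists_join : ∀ s t : S, Compatible s t → ∃ j, IsJoin s t j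
  mul_join : ∀ s t j c : S, Compatible s t → IsJoin s t j → IsJoin (c * s) (c * t) (c * j)
  join_mul : ∀ s t j c : S, Compatible s t → IsJoin s t j → IsJoin (s * c) (t * c) (j * c)

variable (S) in
/-- Boolean inverse semigroups: distributive inverse semigroups whose idempotents form, under the
natural partial order, a generalized Boolean algebra (a distributive lattice with bottom, but not
necessarily a top, that has relative complements). -/
structure IsBooleanInverse : Prop extends IsDistributiveInverse S where
  boolean : ∃ _ : GeneralizedBooleanAlgebra {e : S // IsIdempotentElem e},
    ∀ e f : {e : S // IsIdempotentElem e}, e ≤ f ↔ NatLE (e : S) (f : S)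

/-- Homomorphisms of inverse semigroups with zero. -/
structure IsZeroHom {T : Type*} [SemigroupWithZero T] (f : S → T) : Prop where
  map_mul : ∀ s t : S, f (s * t) = f s * f t
  map_zero : f 0 = 0

/-- Morphisms of distributive inverse semigroups: homomorphisms that preserve binary
compatible joins. -/
structure IsJoinMorphism {T : Type*} [SemigroupWithZero T] (f : S → T) : Prop
    extends IsZeroHom f where
  map_join : ∀ s t j : S, Compatible s t → IsJoin s t j → IsJoin (f s) (f t) (f j)

/-- `β : S → B` exhibits the Boolean inverse semigroup `B` as the Booleanization of the inverse
semigroup with zero `S`: it is an embedding, and every homomorphism from `S` to a Boolean inverse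
semigroup `T` factors through `β` by a unique morphism `B → T`. -/
structure IsBooleanization.{u, v, w'} {S : Type u} [SemigroupWithZero S]
    {B : Type v} [SemigroupWithZero B] (β : S → B) : Prop where
  inverse : IsInverseSemigroup S
  boolean : IsBooleanInverse B
  hom : IsZeroHom β
  injective : Function.Injective β
  universal : ∀ (T : Type w') [SemigroupWithZero T], IsBooleanInverse T →
    ∀ θ : S → T, IsZeroHom θ →
      ∃! γ : B → T, IsJoinMorphism γ ∧ ∀ s : S, γ (β s) = θ s

end Abstract

/-! ### The polycyclic monoid -/

/-- Words with zero in the letters `aᵢ` (`Sum.inl i`) and `aᵢ⁻¹` (`Sum.inr i`). -/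
abbrev PolyWord (n : ℕ) : Type := WithZero (FreeMonoid (Fin n ⊕ Fin n))

/-- The one-letter word. -/
def polyLetter {n : ℕ} (c : Fin n ⊕ Fin n) : PolyWord n :=
  ((FreeMonoid.of c : FreeMonoid (Fin n ⊕ Fin n)) : WithZero (FreeMonoid (Fin n ⊕ Fin n)))

/-- The defining relations `aᵢ⁻¹aᵢ = 1` and `aᵢ⁻¹aⱼ = 0` for `i ≠ j`. -/
inductive PolyRel (n : ℕ) : PolyWord n → PolyWord n → Prop
  | same (i : Fin n) : PolyRel n (polyLetter (Sum.inr i) * polyLetter (Sum.inl i)) 1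
  | diff (i j : Fin n) (h : i ≠ j) :
      PolyRel n (polyLetter (Sum.inr i) * polyLetter (Sum.inl j)) 0

/-- The polycyclic monoid `Pₙ`, by its presentation as a monoid with zero. -/
def Polycyclic (n : ℕ) : Type := (conGen (PolyRel n)).Quotient

namespace Polycyclic

instance (n : ℕ) : Monoid (Polycyclic n) := inferInstanceAs (Monoid (conGen (PolyRel n)).Quotient)

/-- The class of a word. -/
def mk {n : ℕ} : PolyWord n →* Polycyclic n := (conGen (PolyRel n)).mk'

theorem mk_surjective {n : ℕ} : Function.Surjective (mk (n := n)) := Con.mk'_surjective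

instance (n : ℕ) : MonoidWithZero (Polycyclic n) :=
  { (inferInstance : Monoid (Polycyclic n)) with
    zero := mk 0
    zero_mul := fun a => by
      obtain ⟨w, rfl⟩ := mk_surjective a
      exact (map_mul mk 0 w).symm.trans (congrArg mk (zero_mul w))
    mul_zero := fun a => by
      obtain ⟨w, rfl⟩ := mk_surjective a
      exact (map_mul mk w 0).symm.trans (congrArg mk (mul_zero w)) }

/-- The generator `aᵢ`. -/
def gen {n : ℕ} (i : Fin n) : Polycyclic n := mk (polyLetter (Sum.inl i))

/-- The generator `aᵢ⁻¹`. -/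
def genInv {n : ℕ} (i : Fin n) : Polycyclic n := mk (polyLetter (Sum.inr i))

end Polycyclic

/-! ### The symmetric inverse monoid -/

/-- The symmetric inverse monoid `I(X)` of all partial bijections of `X`. -/
def SymInv (X : Type*) : Type _ := X ≃. X

/-- The product is composition of partial functions, the right-hand factor being applied first;
the zero is the empty map. -/
instance (X : Type*) : MonoidWithZero (SymInv X) where
  mul f g := PEquiv.trans g f
  one := PEquiv.refl X
  zero := (⊥ : X ≃. X)
  mul_assoc f g h := (PEquiv.trans_assoc h g f).symm
  one_mul f := PEquiv.trans_refl f
  mul_one f := PEquiv.refl_trans f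
  zero_mul f := PEquiv.trans_bot f
  mul_zero f := PEquiv.bot_trans f

namespace SymInv

variable {X : Type*}

/-- `f.Maps x y` : the partial bijection `f` is defined at `x`, with value `y`. -/
def Maps (f : SymInv X) (x y : X) : Prop := PEquiv.toFun f x = some y

/-- The domain of definition. -/
def dom (f : SymInv X) : Set X := {x | ∃ y, f.Maps x y}

/-- The image. -/
def im (f : SymInv X) : Set X := {y | ∃ x, f.Maps x y}

theorem maps_mul {f g : SymInv X} {x z : X} :
    (f * g).Maps x z ↔ ∃ y, g.Maps x y ∧ f.Maps y z :=
  PEquiv.trans_eq_some g f x z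

theorem maps_one {x y : X} : (1 : SymInv X).Maps x y ↔ x = y :=
  Option.some_inj

theorem not_maps_zero {x y : X} : ¬ (0 : SymInv X).Maps x y := fun h =>
  Option.some_ne_none y (h.symm.trans (PEquiv.bot_apply x))

theorem Maps.right_unique {f : SymInv X} {x y y' : X} (h : f.Maps x y) (h' : f.Maps x y') :
    y = y' := Option.some_inj.1 (h.symm.trans h')

theorem Maps.left_unique {f : SymInv X} {x x' y : X} (h : f.Maps x y) (h' : f.Maps x' y) :
    x = x' := PEquiv.inj f h h'

end SymInv

/-! ### Languages and permissible bijections -/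

section Languages

variable {A : Type*}

/-- The right ideal `YA*` of the free monoid `A* = List A` generated by `Y`. -/
def rightIdeal (Y : Set (List A)) : Set (List A) := {w | ∃ y ∈ Y, ∃ z, w = y ++ z}

/-- Finitely generated right ideals of `A*` (the empty one included). -/
def IsFGRightIdeal (R : Set (List A)) : Prop := ∃ Y : Set (List A), Y.Finite ∧ R = rightIdeal Y

/-- A partial bijection `α` of `A*`, regarded as a bijection from `L₁ = dom α` to `L₂ = im α`, is a
permissible bijection between (reverse) definite languages if `L₁` and `L₂` can be written as
disjoint unions `L₁ = X₁ + R₁`, `L₂ = X₂ + R₂`, with `X₁`, `X₂` finite and `R₁`, `R₂` finitely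
generated right ideals, in such a way that `α` maps `X₁` to `X₂` and `R₁` to `R₂`, and
`α(xz) = α(x)z` for all `x ∈ R₁` and all `z ∈ A*`. In other words, `α` is the disjoint union of a
bijection between finite languages and an isomorphism between finitely generated right ideals. -/
def IsPermissible (α : SymInv (List A)) : Prop :=
  ∃ X₁ R₁ X₂ R₂ : Set (List A),
    X₁.Finite ∧ IsFGRightIdeal R₁ ∧ X₂.Finite ∧ IsFGRightIdeal R₂ ∧
    Disjoint X₁ R₁ ∧ Disjoint X₂ R₂ ∧ α.dom = X₁ ∪ R₁ ∧ α.im = X₂ ∪ R₂ ∧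
    (∀ x ∈ X₁, ∀ y, α.Maps x y → y ∈ X₂) ∧
    (∀ x ∈ R₁, ∀ y, α.Maps x y → y ∈ R₂) ∧
    (∀ x ∈ R₁, ∀ y, α.Maps x y → ∀ z, α.Maps (x ++ z) (y ++ z))

theorem subset_rightIdeal {Y : Set (List A)} {y : List A} (h : y ∈ Y) : y ∈ rightIdeal Y :=
  ⟨y, h, [], by simp⟩

theorem IsFGRightIdeal.append_mem {R : Set (List A)} (h : IsFGRightIdeal R) {x : List A}
    (hx : x ∈ R) (z : List A) : x ++ z ∈ R := by
  obtain ⟨Y, -, rfl⟩ := h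
  obtain ⟨y, hy, w, rfl⟩ := hx
  exact ⟨y, hy, w ++ z, by simp⟩

theorem IsFGRightIdeal.inter {R R' : Set (List A)} (h : IsFGRightIdeal R)
    (h' : IsFGRightIdeal R') : IsFGRightIdeal (R ∩ R') := by
  obtain ⟨Y, hY, rfl⟩ := h
  obtain ⟨Y', hY', rfl⟩ := h'
  refine ⟨(Y ∩ rightIdeal Y') ∪ (Y' ∩ rightIdeal Y),
    (hY.subset Set.inter_subset_left).union (hY'.subset Set.inter_subset_left), ?_⟩
  ext w
  constructor
  · rintro ⟨⟨y, hy, z, rfl⟩, ⟨y', hy', z', h⟩⟩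
    rcases List.prefix_or_prefix_of_prefix (List.prefix_append y z)
      (h ▸ List.prefix_append y' z') with ⟨t, rfl⟩ | ⟨t, rfl⟩
    · exact ⟨y ++ t, Or.inr ⟨hy', y, hy, t, rfl⟩, z', h⟩
    · exact ⟨y' ++ t, Or.inl ⟨hy, y', hy', t, rfl⟩, z, rfl⟩
  · rintro ⟨y, ⟨hy, hy'⟩ | ⟨hy', hy⟩, z, rfl⟩
    · exact ⟨⟨y, hy, z, rfl⟩, IsFGRightIdeal.append_mem ⟨Y', hY', rfl⟩ hy' z⟩
    · exact ⟨IsFGRightIdeal.append_mem ⟨Y, hY, rfl⟩ hy z, ⟨y, hy', z, rfl⟩⟩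

/-- It is enough to find a finitely generated right ideal with finite complement in the domain on
which `α` commutes with right multiplication. -/
theorem IsPermissible.of_ideal {α : SymInv (List A)} {R : Set (List A)} (hR : IsFGRightIdeal R)
    (hd : R ⊆ α.dom) (hf : (α.dom \ R).Finite)
    (he : ∀ x ∈ R, ∀ y, α.Maps x y → ∀ z, α.Maps (x ++ z) (y ++ z)) : IsPermissible α := by
  have hfin : ∀ F : Set (List A), F.Finite → {y | ∃ x ∈ F, α.Maps x y}.Finite := fun F hF =>
    (hF.biUnion (t := fun x => {y | α.Maps x y}) fun x _ =>
      Set.Subsingleton.finite fun _ h _ h' => h.right_unique h').subset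
        fun y ⟨x, hx, h⟩ => Set.mem_biUnion hx h
  refine ⟨α.dom \ R, R, {y | ∃ x ∈ α.dom \ R, α.Maps x y}, {y | ∃ x ∈ R, α.Maps x y},
    hf, hR, hfin _ hf, ?_, Set.disjoint_sdiff_left, ?_, (Set.sdiff_union_of_subset hd).symm, ?_,
    fun x hx y h => ⟨x, hx, h⟩, fun x hx y h => ⟨x, hx, h⟩, he⟩
  · obtain ⟨Y, hY, rfl⟩ := hR
    refine ⟨{y | ∃ x ∈ Y, α.Maps x y}, hfin _ hY, ?_⟩
    ext w
    constructor
    · rintro ⟨x, ⟨y, hy, z, rfl⟩, h⟩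
      obtain ⟨v, hv⟩ := hd (subset_rightIdeal hy)
      exact ⟨v, ⟨y, hy, hv⟩, z, h.right_unique (he y (subset_rightIdeal hy) v hv z)⟩
    · rintro ⟨v, ⟨y, hy, hv⟩, z, rfl⟩
      exact ⟨y ++ z, ⟨y, hy, z, rfl⟩, he y (subset_rightIdeal hy) v hv z⟩
  · rw [Set.disjoint_left]
    rintro y ⟨x, hx, h⟩ ⟨x', hx', h'⟩
    exact hx.2 (h.left_unique h' ▸ hx')
  · ext y
    constructor
    · rintro ⟨x, h⟩
      by_cases hx : x ∈ R
      · exact Or.inr ⟨x, hx, h⟩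
      · exact Or.inl ⟨x, ⟨⟨y, h⟩, hx⟩, h⟩
    · rintro (⟨x, -, h⟩ | ⟨x, -, h⟩) <;> exact ⟨x, h⟩

theorem IsPermissible.one : IsPermissible (1 : SymInv (List A)) := by
  refine IsPermissible.of_ideal (R := Set.univ) ⟨{[]}, Set.finite_singleton _, ?_⟩
    (fun x _ => ⟨x, SymInv.maps_one.2 rfl⟩) (by simp) fun x _ y h z => ?_
  · ext w
    simp [rightIdeal]
  · rw [SymInv.maps_one] at h ⊢
    rw [h]

theorem IsPermissible.zero : IsPermissible (0 : SymInv (List A)) := by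
  refine IsPermissible.of_ideal (R := ∅) ⟨∅, Set.finite_empty, ?_⟩ (Set.empty_subset _) ?_ ?_
  · ext w
    simp [rightIdeal]
  · refine Set.Finite.subset Set.finite_empty ?_
    rintro x ⟨⟨y, h⟩, -⟩
    exact (SymInv.not_maps_zero h).elim
  · rintro x ⟨⟩

theorem IsPermissible.mul {α β : SymInv (List A)} (hα : IsPermissible α) (hβ : IsPermissible β) :
    IsPermissible (α * β) := by
  obtain ⟨X₁, R₁, X₂, R₂, hX₁, hR₁, hX₂, hR₂, -, hd₂, hdom, him, hX, hR, he⟩ := hβ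
  obtain ⟨U, V, -, -, hU, hV, -, -, -, -, hdom', -, -, -, he'⟩ := hα
  have hpre : ∀ F : Set (List A), F.Finite → {x | ∃ y ∈ F, β.Maps x y}.Finite := fun F hF =>
    (hF.biUnion (t := fun y => {x | β.Maps x y}) fun y _ =>
      Set.Subsingleton.finite fun _ h _ h' => h.left_unique h').subset
        fun x ⟨y, hy, h⟩ => Set.mem_biUnion hy h
  have hback : ∀ y ∈ R₂, ∃ x ∈ R₁, β.Maps x y := fun y hy => by
    obtain ⟨x, h⟩ : y ∈ β.im := him ▸ Or.inr hy
    rcases (hdom ▸ ⟨y, h⟩ : x ∈ X₁ ∪ R₁) with hx | hx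
    · exact (Set.disjoint_left.1 hd₂ (hX x hx y h) hy).elim
    · exact ⟨x, hx, h⟩
  refine IsPermissible.of_ideal (R := {x | x ∈ R₁ ∧ ∃ y ∈ R₂ ∩ V, β.Maps x y}) ?_ ?_ ?_ ?_
  · obtain ⟨G, hG, hGe⟩ := hR₂.inter hV
    refine ⟨{x | ∃ g ∈ G, β.Maps x g}, hpre G hG, ?_⟩
    have hG' : ∀ g ∈ G, ∃ x ∈ R₁, β.Maps x g := fun g hg =>
      hback g (hGe ▸ subset_rightIdeal hg : g ∈ R₂ ∩ V).1
    ext w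
    constructor
    · rintro ⟨hw, y, hy, h⟩
      rw [hGe] at hy
      obtain ⟨g, hg, z, rfl⟩ := hy
      obtain ⟨x, hx, hxg⟩ := hG' g hg
      exact ⟨x, ⟨g, hg, hxg⟩, z, h.left_unique (he x hx g hxg z)⟩
    · rintro ⟨x, ⟨g, hg, hxg⟩, z, rfl⟩
      obtain ⟨x', hx', hxg'⟩ := hG' g hg
      obtain rfl := hxg.left_unique hxg'
      exact ⟨hR₁.append_mem hx' z, g ++ z, hGe ▸ ⟨g, hg, z, rfl⟩, he x hx' g hxg z⟩
  · rintro x ⟨-, y, hy, h⟩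
    obtain ⟨v, hv⟩ : y ∈ α.dom := hdom' ▸ Or.inr hy.2
    exact ⟨v, SymInv.maps_mul.2 ⟨y, h, hv⟩⟩
  · refine (hX₁.union (hpre U hU)).subset ?_
    rintro x ⟨⟨v, hv⟩, hx⟩
    obtain ⟨y, hy, hyv⟩ := SymInv.maps_mul.1 hv
    rcases (hdom ▸ ⟨y, hy⟩ : x ∈ X₁ ∪ R₁) with h₁ | h₁
    · exact Or.inl h₁
    · rcases (hdom' ▸ ⟨v, hyv⟩ : y ∈ U ∪ V) with h₂ | h₂
      · exact Or.inr ⟨y, h₂, hy⟩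
      · exact (hx ⟨h₁, y, ⟨hR x h₁ y hy, h₂⟩, hy⟩).elim
  · rintro x ⟨hx, y, hy, h⟩ v hv z
    obtain ⟨y', h', hv'⟩ := SymInv.maps_mul.1 hv
    obtain rfl := h.right_unique h'
    exact SymInv.maps_mul.2 ⟨y ++ z, he x hx y h z, he' y hy.2 v hv' z⟩

end Languages

/-- The Cuntz–Toeplitz monoid `CT(A*)` of degree `n`: all permissible bijections between definite
languages over the alphabet `A = Fin n`. -/
def CuntzToeplitz (n : ℕ) : Type := {α : SymInv (List (Fin n)) // IsPermissible α}

/-- The operations are inherited from the symmetric inverse monoid on `A*`. -/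
instance (n : ℕ) : MonoidWithZero (CuntzToeplitz n) where
  mul α β := ⟨α.1 * β.1, α.2.mul β.2⟩
  one := ⟨1, IsPermissible.one⟩
  zero := ⟨0, IsPermissible.zero⟩
  mul_assoc α β γ := Subtype.ext (mul_assoc α.1 β.1 γ.1)
  one_mul α := Subtype.ext (one_mul α.1)
  mul_one α := Subtype.ext (mul_one α.1)
  zero_mul α := Subtype.ext (zero_mul α.1)
  mul_zero α := Subtype.ext (mul_zero α.1)

end InvSemi

/-! Over a finite alphabet, α is permissible exactly when, from some length N on, it commutes with
right multiplication (`IsPermissible.exists_stable`, `Stable.isPermissible`). Cutting at N presents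
α as a finite join of pieces (`compatJoin_pieces`): a one-point map {x} → {α(x)} for each x in the
domain with |x| < N, and a cylinder map xA* → α(x)A*, xz ↦ α(x)z, for each x with |x| = N. The
cylinder maps are the nonzero elements of Pₙ, by the normal form xy⁻¹ (`eq_zero_or_eq_word_mul`,
`toCT_injective`). The one-point maps are the products xpy⁻¹, where p is the identity of the set
containing only the empty word, and p is the complement in 1 of the join of the idempotents aᵢaᵢ⁻¹.

Given θ, the image of p is therefore forced: it is the complement d of the join of the θ(aᵢaᵢ⁻¹) in
θ(1) (`exists_isComplemented`, `morphism_pt_eq`). So γ(α) must be the join of the elements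
θ(x)dθ(y⁻¹) and θ(xy⁻¹) that correspond to the pieces of α. These are compatible
(`compatible_pieces`), and the join does not depend on N, since a cylinder is the join of its vertex
and its n children (`isJoinSet_cyl`, `isJoinSet_pieces_succ`). Multiplicativity holds because γ(α)
turns each piece of β, cut long enough, into a piece of αβ or into zero (`extension_map_mul`).

In CT(A*) itself everything is read off graphs: the order is inclusion, compatible joins are unions,
and idempotents are identities of definite languages, which form a Boolean algebra. -/

namespace InvSemi

/-! ### Inverse semigroups and finite compatible joins -/

section Abstract

variable {S : Type*} [SemigroupWithZero S]

theorem IsInverseOf.symm {s t : S} (h : IsInverseOf s t) : IsInverseOf t s := ⟨h.2, h.1⟩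

theorem IsInverseOf.of_idem {e : S} (h : IsIdempotentElem e) : IsInverseOf e e := by
  have h' : e * e = e := h
  simp [IsInverseOf, h']

theorem IsInverseOf.idem_left {s t : S} (h : IsInverseOf s t) : IsIdempotentElem (s * t) := by
  rw [IsIdempotentElem, ← mul_assoc, h.1]

theorem isIdempotentElem_zero : IsIdempotentElem (0 : S) := zero_mul 0

namespace IsInverseSemigroup

variable (hS : IsInverseSemigroup S)
include hS

theorem eq_of_inverse {s t t' : S} (h : IsInverseOf s t) (h' : IsInverseOf s t') : t = t' :=
  (hS s).unique h h'

/-- If x is the inverse of ef, then so is fxe, whence x = fxe. This makes x idempotent, hence its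
own inverse; as ef is also inverse to x, ef = x. -/
theorem mul_idem {e f : S} (he : IsIdempotentElem e) (hf : IsIdempotentElem f) :
    IsIdempotentElem (e * f) := by
  have he' : ∀ a, e * (e * a) = e * a := fun a => by rw [← mul_assoc, he]
  have hf' : ∀ a, f * (f * a) = f * a := fun a => by rw [← mul_assoc, hf]
  obtain ⟨x, ⟨h1, h2⟩, -⟩ := hS (e * f)
  simp only [mul_assoc] at h1 h2
  have hx : IsInverseOf (e * f) (f * (x * e)) := by
    constructor
    · simp only [mul_assoc, he', hf']
      exact h1
    · simp only [mul_assoc, he', hf']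
      have := congrArg (fun a => f * (a * e)) h2
      simpa only [mul_assoc] using this
  have hxe : x = f * (x * e) := hS.eq_of_inverse ⟨by simpa only [mul_assoc] using h1,
    by simpa only [mul_assoc] using h2⟩ hx
  have hxx : IsIdempotentElem x := by
    have h3 : (f * (x * e)) * (f * (x * e)) = f * (x * e) := by
      have := congrArg (fun a => f * (a * e)) h2
      simpa only [mul_assoc] using this
    rw [← hxe] at h3
    exact h3
  have : e * f = x := hS.eq_of_inverse (s := x)
    ⟨by simpa only [mul_assoc] using h2, by simpa only [mul_assoc] using h1⟩
    (IsInverseOf.of_idem hxx)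
  rwa [this]

/-- Both ef and fe are inverses of ef, by `mul_idem`. -/
theorem idem_comm {e f : S} (he : IsIdempotentElem e) (hf : IsIdempotentElem f) :
    e * f = f * e := by
  have he' : ∀ a, e * (e * a) = e * a := fun a => by rw [← mul_assoc, he]
  have hf' : ∀ a, f * (f * a) = f * a := fun a => by rw [← mul_assoc, hf]
  have h1 : e * (f * (e * f)) = e * f := by
    simpa only [IsIdempotentElem, mul_assoc] using hS.mul_idem he hf
  have h2 : f * (e * (f * e)) = f * e := by
    simpa only [IsIdempotentElem, mul_assoc] using hS.mul_idem hf he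
  refine hS.eq_of_inverse (s := e * f) (IsInverseOf.of_idem (hS.mul_idem he hf)) ⟨?_, ?_⟩
  · simp only [mul_assoc, he', hf', h1]
  · simp only [mul_assoc, he', hf', h2]

theorem inverse_mul {a a' b b' : S} (ha : IsInverseOf a a') (hb : IsInverseOf b b') :
    IsInverseOf (a * b) (b' * a') := by
  have h : b * b' * (a' * a) = a' * a * (b * b') :=
    hS.idem_comm hb.idem_left ha.symm.idem_left
  constructor
  · calc a * b * (b' * a') * (a * b) = a * (b * b' * (a' * a)) * b := by simp only [mul_assoc]
      _ = (a * a' * a) * (b * b' * b) := by rw [h]; simp only [mul_assoc]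
      _ = a * b := by rw [ha.1, hb.1]
  · calc b' * a' * (a * b) * (b' * a') = b' * (a' * a * (b * b')) * a' := by
          simp only [mul_assoc]
      _ = (b' * b * b') * (a' * a * a') := by rw [← h]; simp only [mul_assoc]
      _ = b' * a' := by rw [ha.2, hb.2]

theorem idem_of_inverse {e f : S} (he : IsIdempotentElem e) (h : IsInverseOf e f) :
    IsIdempotentElem f :=
  hS.eq_of_inverse (IsInverseOf.of_idem he) h ▸ he

theorem conj_idem {c c' e : S} (hc : IsInverseOf c c') (he : IsIdempotentElem e) :
    IsIdempotentElem (c' * e * c) := by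
  have h := hS.idem_comm hc.idem_left he
  calc c' * e * c * (c' * e * c) = c' * e * (c * c' * e) * c := by simp only [mul_assoc]
    _ = c' * (e * e) * (c * c' * c) := by rw [h]; simp only [mul_assoc]
    _ = c' * e * c := by rw [he.eq, hc.1]

theorem natLE_refl (s : S) : NatLE s s := by
  obtain ⟨t, h, -⟩ := hS s
  exact ⟨t * s, h.symm.idem_left, by rw [← mul_assoc, h.1]⟩

theorem natLE_trans {s t u : S} (h : NatLE s t) (h' : NatLE t u) : NatLE s u := by
  obtain ⟨e, he, rfl⟩ := h
  obtain ⟨f, hf, rfl⟩ := h'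
  exact ⟨f * e, hS.mul_idem hf he, mul_assoc _ _ _⟩

theorem natLE_antisymm {s t : S} (h : NatLE s t) (h' : NatLE t s) : s = t := by
  obtain ⟨e, he, hs⟩ := h
  obtain ⟨f, hf, ht⟩ := h'
  have h1 : s * e = s := by rw [hs, mul_assoc, he.eq]
  have h2 : s * f = s := by
    calc s * f = s * e * f := by rw [h1]
      _ = s * f * e := by rw [mul_assoc, hS.idem_comm he hf, mul_assoc]
      _ = s := by rw [← ht, hs]
  rw [ht, h2]

theorem natLE_mul_right {s t : S} (h : NatLE s t) (c : S) : NatLE (s * c) (t * c) := by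
  obtain ⟨e, he, rfl⟩ := h
  obtain ⟨c', hc, -⟩ := hS c
  refine ⟨c' * e * c, hS.conj_idem hc he, ?_⟩
  calc t * e * c = t * e * (c * c' * c) := by rw [hc.1]
    _ = t * (e * (c * c')) * c := by simp only [mul_assoc]
    _ = t * c * (c' * e * c) := by
      rw [hS.idem_comm he hc.idem_left]; simp only [mul_assoc]

theorem idem_of_natLE {s e : S} (he : IsIdempotentElem e) (h : NatLE s e) :
    IsIdempotentElem s := by
  obtain ⟨f, hf, rfl⟩ := h
  exact hS.mul_idem he hf

theorem compatible_comm {s t : S} (h : Compatible s t) : Compatible t s := by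
  obtain ⟨s', t', hs, ht, h1, h2⟩ := h
  exact ⟨t', s', ht, hs, hS.idem_of_inverse h1 (hS.inverse_mul hs.symm ht),
    hS.idem_of_inverse h2 (hS.inverse_mul hs ht.symm)⟩

theorem compatible_refl (s : S) : Compatible s s := by
  obtain ⟨t, h, -⟩ := hS s
  exact ⟨t, t, h, h, h.symm.idem_left, h.idem_left⟩

theorem compatible_of_idem {e f : S} (he : IsIdempotentElem e) (hf : IsIdempotentElem f) :
    Compatible e f :=
  ⟨e, f, .of_idem he, .of_idem hf, hS.mul_idem he hf, hS.mul_idem he hf⟩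

theorem compatible_zero (s : S) : Compatible s 0 := by
  obtain ⟨t, h, -⟩ := hS s
  exact ⟨t, 0, h, .of_idem isIdempotentElem_zero, by simp [IsIdempotentElem],
    by simp [IsIdempotentElem]⟩

theorem join_unique {s t j k : S} (h : IsJoin s t j) (h' : IsJoin s t k) : j = k :=
  hS.natLE_antisymm (h.2.2 k h'.1 h'.2.1) (h'.2.2 j h.1 h.2.1)

theorem compatible_mul_left {s t : S} (h : Compatible s t) (c : S) :
    Compatible (c * s) (c * t) := by
  obtain ⟨s', t', hs, ht, h1, h2⟩ := h
  obtain ⟨c', hc, -⟩ := hS c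
  refine ⟨s' * c', t' * c', hS.inverse_mul hc hs, hS.inverse_mul hc ht, ?_, ?_⟩
  · rw [show s' * c' * (c * t) = s' * (c' * c) * t by simp only [mul_assoc]]
    exact hS.idem_of_natLE h1 (hS.natLE_mul_right ⟨c' * c, hc.symm.idem_left, rfl⟩ t)
  · rw [show c * s * (t' * c') = c * (s * t') * c' by simp only [mul_assoc]]
    exact hS.conj_idem hc.symm h2

/-- A join of two idempotents is idempotent. -/
theorem idem_of_join {e f j : S} (he : IsIdempotentElem e) (hf : IsIdempotentElem f)
    (h : IsJoin e f j) : IsIdempotentElem j := by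
  obtain ⟨j', hj, -⟩ := hS j
  -- If g = ju is idempotent, its inverse uj' equals g, and g = gg = uj'ju shows g ≤ j'j. So e and
  -- f, hence j, lie below the idempotent j'j.
  have key : ∀ g, IsIdempotentElem g → NatLE g j → NatLE g (j' * j) := by
    rintro g hg ⟨u, hu, hgu⟩
    have h1 : IsInverseOf g (u * j') := by
      rw [hgu]; exact hS.inverse_mul hj (.of_idem hu)
    have h2 : g = u * j' := hS.eq_of_inverse (.of_idem hg) h1
    refine ⟨u, hu, ?_⟩
    calc g = g * g := hg.symm
      _ = u * (j' * j) * u := by rw [mul_assoc u, mul_assoc j', ← hgu, ← mul_assoc, ← h2]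
      _ = j' * j * u := by
        rw [hS.idem_comm hu hj.symm.idem_left, mul_assoc, hu.eq]
  exact hS.idem_of_natLE hj.symm.idem_left (h.2.2 _ (key e he h.1) (key f hf h.2.1))

end IsInverseSemigroup

theorem zero_natLE (s : S) : NatLE 0 s := ⟨0, isIdempotentElem_zero, (mul_zero s).symm⟩

/-- `j` is the least upper bound of the set `F` in the natural partial order. -/
def IsJoinSet (F : Set S) (j : S) : Prop :=
  (∀ s ∈ F, NatLE s j) ∧ ∀ k, (∀ s ∈ F, NatLE s k) → NatLE j k

/-- `j` is obtained from the elements of the finite set `F` by successive compatible joins. -/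
inductive CompatJoin : Set S → S → Prop
  | empty : CompatJoin ∅ 0
  | insert {F : Set S} {j : S} (a k : S) : CompatJoin F j → Compatible a j → IsJoin a j k →
      CompatJoin (insert a F) k

theorem IsInverseSemigroup.joinSet_unique (hS : IsInverseSemigroup S) {F : Set S} {j k : S}
    (h : IsJoinSet F j) (h' : IsJoinSet F k) : j = k :=
  hS.natLE_antisymm (h.2 k h'.1) (h'.2 j h.1)

theorem IsInverseSemigroup.isJoinSet_singleton (hS : IsInverseSemigroup S) (s : S) :
    IsJoinSet {s} s :=
  ⟨by simpa using hS.natLE_refl s, fun k h => h s rfl⟩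

theorem isJoinSet_empty : IsJoinSet (∅ : Set S) 0 := ⟨by simp, fun k _ => zero_natLE k⟩

theorem IsInverseSemigroup.isJoinSet_insert (hS : IsInverseSemigroup S) {F : Set S} {a j k : S}
    (hj : IsJoinSet F j) (h : IsJoin a j k) : IsJoinSet (insert a F) k := by
  refine ⟨?_, fun l hl => h.2.2 l (hl a (Set.mem_insert _ _))
    (hj.2 l fun s hs => hl s (Set.mem_insert_of_mem _ hs))⟩
  rintro s (rfl | hs)
  · exact h.1
  · exact hS.natLE_trans (hj.1 s hs) h.2.1

theorem IsInverseSemigroup.isJoin_of_union (hS : IsInverseSemigroup S) {F G : Set S} {a b j : S}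
    (ha : IsJoinSet F a) (hb : IsJoinSet G b) (h : IsJoinSet (F ∪ G) j) : IsJoin a b j :=
  ⟨ha.2 j fun s hs => h.1 s (Or.inl hs), hb.2 j fun s hs => h.1 s (Or.inr hs), fun k h1 h2 =>
    h.2 k fun s hs => hs.elim (fun hs => hS.natLE_trans (ha.1 s hs) h1)
      fun hs => hS.natLE_trans (hb.1 s hs) h2⟩

theorem IsZeroHom.isInverseOf {T : Type*} [SemigroupWithZero T] {f : S → T} (hf : IsZeroHom f)
    {s t : S} (h : IsInverseOf s t) : IsInverseOf (f s) (f t) :=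
  ⟨by rw [← hf.map_mul, ← hf.map_mul, h.1], by rw [← hf.map_mul, ← hf.map_mul, h.2]⟩

theorem IsZeroHom.isIdempotentElem {T : Type*} [SemigroupWithZero T] {f : S → T}
    (hf : IsZeroHom f) {e : S} (h : IsIdempotentElem e) : IsIdempotentElem (f e) := by
  rw [IsIdempotentElem, ← hf.map_mul, h.eq]

theorem IsZeroHom.compatible {T : Type*} [SemigroupWithZero T] {f : S → T} (hf : IsZeroHom f)
    {s t : S} (h : Compatible s t) : Compatible (f s) (f t) := by
  obtain ⟨s', t', hs, ht, h1, h2⟩ := h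
  refine ⟨f s', f t', hf.isInverseOf hs, hf.isInverseOf ht, ?_, ?_⟩
  · rw [← hf.map_mul]
    exact hf.isIdempotentElem h1
  · rw [← hf.map_mul]
    exact hf.isIdempotentElem h2

namespace CompatJoin

variable {F : Set S} {j : S}

theorem isJoinSet (h : CompatJoin F j) (hS : IsInverseSemigroup S) : IsJoinSet F j := by
  induction h with
  | empty => exact isJoinSet_empty
  | insert a k _ _ h ih => exact hS.isJoinSet_insert ih h

theorem idem (h : CompatJoin F j) (hS : IsInverseSemigroup S)
    (hF : ∀ s ∈ F, IsIdempotentElem s) : IsIdempotentElem j := by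
  induction h with
  | empty => exact isIdempotentElem_zero
  | insert a k _ _ h ih =>
    exact hS.idem_of_join (hF a (Set.mem_insert _ _))
      (ih fun s hs => hF s (Set.mem_insert_of_mem _ hs)) h

/-- Distributivity is given for binary compatible joins only. It passes to finite joins by induction
on how the join was built, a history that `CompatJoin` records and `IsJoinSet` does not. -/
theorem mul_left (h : CompatJoin F j) (hS : IsDistributiveInverse S) (c : S) :
    IsJoinSet ((fun s => c * s) '' F) (c * j) := by
  induction h with
  | empty => simpa using isJoinSet_empty
  | insert a k _ hc h ih =>
    rw [Set.image_insert_eq]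
    exact hS.inverse.isJoinSet_insert ih (hS.mul_join _ _ _ c hc h)

theorem mul_right (h : CompatJoin F j) (hS : IsDistributiveInverse S) (c : S) :
    IsJoinSet ((fun s => s * c) '' F) (j * c) := by
  induction h with
  | empty => simpa using isJoinSet_empty
  | insert a k _ hc h ih =>
    rw [Set.image_insert_eq]
    exact hS.inverse.isJoinSet_insert ih (hS.join_mul _ _ _ c hc h)

theorem mul_mul (h : CompatJoin F j) (hS : IsDistributiveInverse S) (c d : S) :
    IsJoinSet ((fun s => c * s * d) '' F) (c * j * d) := by
  induction h with
  | empty => simpa using isJoinSet_empty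
  | insert a k _ hc h ih =>
    rw [Set.image_insert_eq]
    exact hS.inverse.isJoinSet_insert ih
      (hS.join_mul _ _ _ d (hS.inverse.compatible_mul_left hc c) (hS.mul_join _ _ _ c hc h))

theorem map {T : Type*} [SemigroupWithZero T] (h : CompatJoin F j) {f : S → T}
    (hf : IsJoinMorphism f) : CompatJoin (f '' F) (f j) := by
  induction h with
  | empty => simpa [hf.map_zero] using CompatJoin.empty (S := T)
  | insert a k _ hc h ih =>
    rw [Set.image_insert_eq]
    exact .insert _ _ ih (hf.toIsZeroHom.compatible hc) (hf.map_join _ _ _ hc h)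

/-- By distributivity a'k is the join of the idempotents a'b and a'j. The other product ak' is the
inverse of ka', the join of ba' and ja'. -/
theorem compatible (h : CompatJoin F j) (hS : IsDistributiveInverse S) {a : S}
    (ha : ∀ s ∈ F, Compatible a s) : Compatible a j := by
  have hI := hS.inverse
  induction h with
  | empty => exact hI.compatible_zero a
  | insert b k _ hc h ih =>
    obtain ⟨a', b', iva, ivb, h1, h2⟩ := ha b (Set.mem_insert _ _)
    obtain ⟨a'', j', iva', ivj, h3, h4⟩ := ih fun s hs => ha s (Set.mem_insert_of_mem _ hs)
    obtain rfl := hI.eq_of_inverse iva iva'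
    obtain ⟨k', ivk, -⟩ := hI k
    refine ⟨a', k', iva, ivk, hI.idem_of_join h1 h3 (hS.mul_join _ _ _ a' hc h),
      hI.idem_of_inverse ?_ (hI.inverse_mul ivk iva.symm)⟩
    exact hI.idem_of_join (hI.idem_of_inverse h2 (hI.inverse_mul iva ivb.symm))
      (hI.idem_of_inverse h4 (hI.inverse_mul iva ivj.symm)) (hS.join_mul _ _ _ a' hc h)

end CompatJoin

/-- Finite compatible sets have joins. -/
theorem IsDistributiveInverse.exists_compatJoin (hS : IsDistributiveInverse S) {F : Set S}
    (hF : F.Finite) (hc : ∀ s ∈ F, ∀ t ∈ F, Compatible s t) : ∃ j, CompatJoin F j := by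
  induction F, hF using Set.Finite.induction_on with
  | empty => exact ⟨0, .empty⟩
  | @insert a F _ _ ih =>
    obtain ⟨j, hj⟩ := ih fun s hs t ht =>
      hc s (Set.mem_insert_of_mem _ hs) t (Set.mem_insert_of_mem _ ht)
    have haj := hj.compatible hS fun s hs => hc a (Set.mem_insert _ _) s (Set.mem_insert_of_mem _ hs)
    obtain ⟨k, hk⟩ := hS.exists_join a j haj
    exact ⟨k, .insert a k hj haj hk⟩

theorem IsDistributiveInverse.compatJoin_of_isJoinSet (hS : IsDistributiveInverse S) {F : Set S}
    (hF : F.Finite) (hc : ∀ s ∈ F, ∀ t ∈ F, Compatible s t) {j : S} (hj : IsJoinSet F j) :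
    CompatJoin F j := by
  obtain ⟨k, hk⟩ := hS.exists_compatJoin hF hc
  rwa [hS.inverse.joinSet_unique hj (hk.isJoinSet hS.inverse)]

/-- Relative complements of finite joins of idempotents. -/
theorem IsBooleanInverse.exists_compl (hS : IsBooleanInverse S) {e : S} {G : Set S}
    (he : IsIdempotentElem e) (hG : G.Finite) (hi : ∀ g ∈ G, IsIdempotentElem g)
    (hGe : ∀ g ∈ G, NatLE g e) :
    ∃ d, IsIdempotentElem d ∧ e * d = d ∧ (∀ g ∈ G, d * g = 0) ∧ CompatJoin (insert d G) e := by
  have hI := hS.inverse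
  obtain ⟨f, hf⟩ := hS.exists_compatJoin hG fun s hs t ht =>
    hI.compatible_of_idem (hi s hs) (hi t ht)
  have hfi := hf.idem hI hi
  have hfJ := hf.isJoinSet hI
  have hfe : NatLE f e := hfJ.2 e hGe
  obtain ⟨B, hB⟩ := hS.boolean
  set E : {e : S // IsIdempotentElem e} := ⟨e, he⟩
  set F : {e : S // IsIdempotentElem e} := ⟨f, hfi⟩
  have hFE : F ≤ E := (hB _ _).2 hfe
  set D := E \ F
  have hbot : ((⊥ : {e : S // IsIdempotentElem e}) : S) = 0 := by
    obtain ⟨u, -, hu⟩ := (hB ⊥ ⟨0, isIdempotentElem_zero⟩).1 bot_le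
    rw [hu, zero_mul]
  have hDE : NatLE (D : S) e := (hB D E).1 sdiff_le
  have hcomp : Compatible (D : S) f := hI.compatible_of_idem D.2 hfi
  obtain ⟨j, hj⟩ := hS.exists_join _ _ hcomp
  have hje : j = e := by
    refine hI.natLE_antisymm (hj.2.2 e hDE hfe) ?_
    -- The lattice join is least among idempotents only; it can be compared with j because j is
    -- itself idempotent.
    let J : {e : S // IsIdempotentElem e} := ⟨j, hI.idem_of_join D.2 hfi hj⟩
    have : D ⊔ F ≤ J := sup_le ((hB _ _).2 hj.1) ((hB _ _).2 hj.2.1)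
    rw [sdiff_sup_cancel hFE] at this
    exact (hB _ _).1 this
  refine ⟨D, D.2, ?_, fun g hg => ?_, .insert _ _ hf hcomp (hje ▸ hj)⟩
  · obtain ⟨u, -, hu⟩ := hDE
    rw [hu, ← mul_assoc, he.eq]
  · let P : {e : S // IsIdempotentElem e} := ⟨D * g, hI.mul_idem D.2 (hi g hg)⟩
    have h1 : P ≤ D := (hB _ _).2 ⟨g, hi g hg, rfl⟩
    have h2 : P ≤ F := (hB _ _).2 (hI.natLE_trans ⟨D, D.2, hI.idem_comm D.2 (hi g hg)⟩
      (hfJ.1 g hg))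
    have h3 : P = ⊥ := disjoint_sdiff_self_left h1 h2 |> le_bot_iff.1
    rw [← hbot, ← h3]

end Abstract

/-! ### Partial bijections from graphs -/

/-- The partial bijection with a given graph. -/
noncomputable def SymInv.ofRel {X : Type*} (r : X → X → Prop)
    (h : ∀ x y x' y', r x y → r x' y' → (x = x' ↔ y = y')) : SymInv X := by
  classical
  exact
  { toFun := fun x => if h : ∃ y, r x y then some h.choose else none
    invFun := fun y => if h : ∃ x, r x y then some h.choose else none
    inv := fun x y => by
      have key : ∀ {p : X → Prop} (_ : ∀ a b, p a → p b → a = b) (a : X),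
          ((if h : ∃ y, p y then some h.choose else none) = some a) ↔ p a := by
        intro p hp a
        split_ifs with hex
        · exact ⟨fun e => Option.some_inj.1 e ▸ hex.choose_spec,
            fun ha => congrArg some (hp _ _ hex.choose_spec ha)⟩
        · exact ⟨fun e => by simp at e, fun ha => (hex ⟨a, ha⟩).elim⟩
      rw [key fun a b ha hb => (h a y b y ha hb).2 rfl,
        key fun a b ha hb => (h x a x b ha hb).1 rfl] }

@[simp]
theorem SymInv.maps_ofRel {X : Type*} {r : X → X → Prop}
    {h : ∀ x y x' y', r x y → r x' y' → (x = x' ↔ y = y')} {x y : X} :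
    (SymInv.ofRel r h).Maps x y ↔ r x y := by
  classical
  change ((if h : ∃ y, r x y then some h.choose else none) = some y) ↔ _
  split_ifs with hex
  · exact ⟨fun e => Option.some_inj.1 e ▸ hex.choose_spec,
      fun ha => congrArg some ((h _ _ _ _ hex.choose_spec ha).1 rfl)⟩
  · exact ⟨fun e => by simp at e, fun ha => (hex ⟨y, ha⟩).elim⟩

theorem SymInv.ext_maps {X : Type*} {f g : SymInv X} (h : ∀ x y, f.Maps x y ↔ g.Maps x y) :
    f = g :=
  PEquiv.ext fun x => Option.ext fun y => h x y

theorem SymInv.Maps.eq_iff {X : Type*} {f : SymInv X} {x y x' y' : X} (h : f.Maps x y)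
    (h' : f.Maps x' y') : x = x' ↔ y = y' :=
  ⟨fun e => h.right_unique (e ▸ h'), fun e => h.left_unique (e ▸ h')⟩

/-! ### Permissibility as stability on long words -/

section Languages

variable {A : Type*}

/-- From length `N` on, `α` commutes with right multiplication. -/
def Stable (α : SymInv (List A)) (N : ℕ) : Prop :=
  ∀ w : List A, N ≤ w.length → ∀ z u, α.Maps (w ++ z) u ↔ ∃ y, α.Maps w y ∧ u = y ++ z

theorem Stable.mono {α : SymInv (List A)} {N M : ℕ} (h : Stable α N) (hNM : N ≤ M) :
    Stable α M := fun w hw => h w (hNM.trans hw)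

theorem exists_length_bound {F : Set (List A)} (hF : F.Finite) : ∃ N, ∀ w ∈ F, w.length < N := by
  obtain ⟨N, hN⟩ := (hF.image List.length).bddAbove
  exact ⟨N + 1, fun w hw => Nat.lt_succ_of_le (hN ⟨w, hw, rfl⟩)⟩

/-- N exceeds the lengths of all words in X₁ and Y. If |w| ≥ N and wz is in the domain, then wz is
too long for X₁, so it has a prefix in Y, and that prefix already lies inside w. -/
theorem IsPermissible.exists_stable {α : SymInv (List A)} (h : IsPermissible α) :
    ∃ N, Stable α N := by
  obtain ⟨X₁, R₁, X₂, R₂, hX₁, ⟨Y, hY, rfl⟩, -, -, -, -, hdom, -, -, -, he⟩ := h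
  obtain ⟨N, hN⟩ := exists_length_bound (hX₁.union hY)
  refine ⟨N, fun w hw z u => ?_⟩
  have key : w ++ z ∈ α.dom → w ∈ rightIdeal Y := by
    intro hd
    rw [hdom] at hd
    rcases hd with hd | ⟨y, hy, v, hv⟩
    · have := hN _ (Or.inl hd)
      simp at this
      omega
    · obtain ⟨t, ht⟩ := List.prefix_of_prefix_length_le (hv ▸ List.prefix_append y v)
        (List.prefix_append w z) ((hN y (Or.inr hy)).le.trans hw)
      exact ⟨y, hy, t, ht.symm⟩
  constructor
  · intro hm
    have hw' := key ⟨u, hm⟩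
    obtain ⟨y, hy⟩ : w ∈ α.dom := hdom ▸ Or.inr hw'
    exact ⟨y, hy, hm.right_unique (he w hw' y hy z)⟩
  · rintro ⟨y, hy, rfl⟩
    rcases (hdom ▸ ⟨y, hy⟩ : w ∈ X₁ ∪ rightIdeal Y) with h₁ | h₁
    · exact absurd (hN w (Or.inl h₁)) (by omega)
    · exact he w h₁ y hy z

/-- The domain words of length at least N form the right ideal generated by those of length N. These
generators, and the remaining shorter words, are finite in number because A is finite. -/
theorem Stable.isPermissible [Finite A] {α : SymInv (List A)} {N : ℕ} (h : Stable α N) :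
    IsPermissible α := by
  refine IsPermissible.of_ideal (R := {w | N ≤ w.length ∧ w ∈ α.dom})
    ⟨{w | w.length = N ∧ w ∈ α.dom}, (List.finite_length_eq A N).subset fun w hw => hw.1, ?_⟩
    (fun w hw => hw.2) ((List.finite_length_lt A N).subset ?_) ?_
  · ext w
    constructor
    · rintro ⟨hw, u, hu⟩
      have hl : (w.take N).length = N := by simpa using hw
      rw [← List.take_append_drop N w, h _ hl.ge] at hu
      obtain ⟨y, hy, -⟩ := hu
      exact ⟨w.take N, ⟨hl, y, hy⟩, w.drop N, (List.take_append_drop N w).symm⟩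
    · rintro ⟨v, ⟨hv, y, hy⟩, z, rfl⟩
      exact ⟨by simp [hv], y ++ z, (h v hv.ge z _).2 ⟨y, hy, rfl⟩⟩
  · rintro w ⟨hw, hn⟩
    by_contra hlt
    exact hn ⟨not_lt.1 hlt, hw⟩
  · rintro w ⟨hw, -⟩ y hy z
    exact (h w hw z _).2 ⟨y, hy, rfl⟩

end Languages

/-! ### CT(A*) is a Boolean inverse monoid -/

namespace CuntzToeplitz

variable {n : ℕ}

theorem ext_maps {α β : CuntzToeplitz n} (h : ∀ x y, α.1.Maps x y ↔ β.1.Maps x y) : α = β :=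
  Subtype.ext (SymInv.ext_maps h)

theorem maps_mul {α β : CuntzToeplitz n} {x z : List (Fin n)} :
    (α * β).1.Maps x z ↔ ∃ y, β.1.Maps x y ∧ α.1.Maps y z := SymInv.maps_mul

theorem maps_one {x y : List (Fin n)} : (1 : CuntzToeplitz n).1.Maps x y ↔ x = y :=
  SymInv.maps_one

theorem not_maps_zero {x y : List (Fin n)} : ¬ (0 : CuntzToeplitz n).1.Maps x y :=
  SymInv.not_maps_zero

/-- The permissible bijection with a given stable graph. -/
noncomputable def ofRel (r : List (Fin n) → List (Fin n) → Prop)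
    (h : ∀ x y x' y', r x y → r x' y' → (x = x' ↔ y = y'))
    (hs : ∃ N, ∀ w : List (Fin n), N ≤ w.length → ∀ z u, r (w ++ z) u ↔ ∃ y, r w y ∧ u = y ++ z) :
    CuntzToeplitz n :=
  ⟨SymInv.ofRel r h, by
    obtain ⟨N, hN⟩ := hs
    exact Stable.isPermissible (N := N) (by simpa [Stable] using hN)⟩

@[simp]
theorem maps_ofRel {r : List (Fin n) → List (Fin n) → Prop} {h hs} {x y : List (Fin n)} :
    (ofRel r h hs).1.Maps x y ↔ r x y := SymInv.maps_ofRel (h := h)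

theorem exists_stable (α : CuntzToeplitz n) : ∃ N, Stable α.1 N := α.2.exists_stable

theorem maps_of_isInverseOf {α β : CuntzToeplitz n} (h : IsInverseOf α β) {x y : List (Fin n)}
    (hxy : α.1.Maps x y) : β.1.Maps y x := by
  rw [← h.1] at hxy
  obtain ⟨u, hu, hy⟩ := maps_mul.1 hxy
  obtain ⟨v, hv, hvy⟩ := maps_mul.1 hy
  have h1 : α.1.Maps x y := by rwa [h.1] at hxy
  obtain rfl := h1.right_unique hu
  obtain rfl := h1.left_unique hvy
  exact hv

theorem isInverseOf_iff {α β : CuntzToeplitz n} :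
    IsInverseOf α β ↔ ∀ x y, α.1.Maps x y ↔ β.1.Maps y x := by
  refine ⟨fun h x y => ⟨maps_of_isInverseOf h, maps_of_isInverseOf h.symm⟩, fun h => ⟨?_, ?_⟩⟩
  · refine ext_maps fun x y => ⟨fun hm => ?_, fun hm => ?_⟩
    · obtain ⟨u, hu, hy⟩ := maps_mul.1 hm
      obtain ⟨v, hv, hvy⟩ := maps_mul.1 hy
      obtain rfl := hu.left_unique ((h _ _).2 hv)
      exact hvy
    · exact maps_mul.2 ⟨y, hm, maps_mul.2 ⟨x, (h _ _).1 hm, hm⟩⟩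
  · refine ext_maps fun x y => ⟨fun hm => ?_, fun hm => ?_⟩
    · obtain ⟨u, hu, hy⟩ := maps_mul.1 hm
      obtain ⟨v, hv, hvy⟩ := maps_mul.1 hy
      obtain rfl := hu.left_unique ((h _ _).1 hv)
      exact hvy
    · exact maps_mul.2 ⟨y, hm, maps_mul.2 ⟨x, (h _ _).2 hm, hm⟩⟩

/-- The decomposition in `IsPermissible` can be read backwards, whereas `Stable` bounds lengths on
the domain side only; hence the return to the definition. -/
theorem exists_inverse (α : CuntzToeplitz n) : ∃ β : CuntzToeplitz n, IsInverseOf α β := by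
  obtain ⟨α, h⟩ := α
  obtain ⟨X₁, R₁, X₂, R₂, hX₁, hR₁, hX₂, hR₂, hd₁, hd₂, hdom, him, hX, hR, he⟩ := h
  have hm : ∀ x y, (SymInv.ofRel (fun y x => α.Maps x y)
      fun x y x' y' h h' => (h.eq_iff h').symm).Maps x y ↔ α.Maps y x :=
    fun x y => SymInv.maps_ofRel
  refine ⟨⟨SymInv.ofRel (fun y x => α.Maps x y)
    fun x y x' y' h h' => (h.eq_iff h').symm, ?_⟩,
    isInverseOf_iff.2 fun x y => (hm _ _).symm⟩
  have hback : ∀ y ∈ R₂, ∀ x, α.Maps x y → x ∈ R₁ := fun y hy x h => by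
    rcases (hdom ▸ ⟨y, h⟩ : x ∈ X₁ ∪ R₁) with hx | hx
    · exact (Set.disjoint_left.1 hd₂ (hX x hx y h) hy).elim
    · exact hx
  refine ⟨X₂, R₂, X₁, R₁, hX₂, hR₂, hX₁, hR₁, hd₂, hd₁, ?_, ?_, ?_, ?_, ?_⟩
  · rw [← him]; simp only [SymInv.dom, SymInv.im, hm]
  · rw [← hdom]; simp only [SymInv.dom, SymInv.im, hm]
  · intro y hy x h
    rw [hm] at h
    rcases (hdom ▸ ⟨y, h⟩ : x ∈ X₁ ∪ R₁) with hx | hx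
    · exact hx
    · exact (Set.disjoint_left.1 hd₂ hy (hR x hx y h)).elim
  · intro y hy x h
    exact hback y hy x ((hm _ _).1 h)
  · intro y hy x h z
    rw [hm] at h ⊢
    exact he x (hback y hy x h) y h z

theorem isInverseSemigroup : IsInverseSemigroup (CuntzToeplitz n) := fun α => by
  obtain ⟨β, hβ⟩ := exists_inverse α
  refine ⟨β, hβ, fun γ hγ => ext_maps fun x y => ?_⟩
  rw [← isInverseOf_iff.1 hβ, ← isInverseOf_iff.1 hγ]

theorem isIdempotentElem_iff {α : CuntzToeplitz n} :
    IsIdempotentElem α ↔ ∀ x y, α.1.Maps x y → x = y := by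
  constructor
  · intro h x y hxy
    have h1 : (α * α).1.Maps x y := by rwa [h.eq]
    obtain ⟨u, hu, huy⟩ := maps_mul.1 h1
    obtain rfl := hu.right_unique hxy
    exact hxy.left_unique huy
  · refine fun h => ext_maps fun x y => ⟨fun hm => ?_, fun hm => ?_⟩
    · obtain ⟨u, hu, huy⟩ := maps_mul.1 hm
      rwa [h x u hu]
    · obtain rfl := h x y hm
      exact maps_mul.2 ⟨x, hm, hm⟩

theorem natLE_iff {α β : CuntzToeplitz n} :
    NatLE α β ↔ ∀ x y, α.1.Maps x y → β.1.Maps x y := by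
  constructor
  · rintro ⟨ε, hε, rfl⟩ x y hm
    obtain ⟨u, hu, huy⟩ := maps_mul.1 hm
    rwa [isIdempotentElem_iff.1 hε x u hu]
  · intro h
    obtain ⟨α', hα⟩ := exists_inverse α
    -- The idempotent α'α is the identity of the domain of α.
    refine ⟨α' * α, hα.symm.idem_left, ext_maps fun x y => ⟨fun hm => ?_, fun hm => ?_⟩⟩
    · exact maps_mul.2 ⟨x, maps_mul.2 ⟨y, hm, (isInverseOf_iff.1 hα x y).1 hm⟩, h x y hm⟩
    · obtain ⟨u, hu, huy⟩ := maps_mul.1 hm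
      obtain ⟨v, hv, hvu⟩ := maps_mul.1 hu
      have h1 := (isInverseOf_iff.1 hα u v).2 hvu
      obtain rfl := hv.left_unique h1
      rwa [huy.right_unique (h _ _ hv)]

/-- Idempotency of αβ' makes α and β agree where both are defined, and that of α'β does the same for
their inverses. This is what makes the union of the graphs a partial bijection. -/
theorem eq_iff_of_compatible {α β : CuntzToeplitz n} (h : Compatible α β)
    {x y x' y' : List (Fin n)} (hα : α.1.Maps x y) (hβ : β.1.Maps x' y') : x = x' ↔ y = y' := by
  obtain ⟨α', β', ha, hb, h1, h2⟩ := h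
  constructor
  · rintro rfl
    exact (isIdempotentElem_iff.1 h2 _ _
      (maps_mul.2 ⟨x, (isInverseOf_iff.1 hb _ _).1 hβ, hα⟩)).symm
  · rintro rfl
    exact (isIdempotentElem_iff.1 h1 _ _
      (maps_mul.2 ⟨y, hβ, (isInverseOf_iff.1 ha _ _).1 hα⟩)).symm

theorem isJoinSet_of_maps {F : Set (CuntzToeplitz n)} {δ : CuntzToeplitz n}
    (h : ∀ x y, δ.1.Maps x y ↔ ∃ α ∈ F, α.1.Maps x y) : IsJoinSet F δ := by
  refine ⟨fun α hα => natLE_iff.2 fun x y hm => (h x y).2 ⟨α, hα, hm⟩, fun κ hκ => ?_⟩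
  refine natLE_iff.2 fun x y hm => ?_
  obtain ⟨α, hα, hm⟩ := (h x y).1 hm
  exact natLE_iff.1 (hκ α hα) x y hm

theorem isJoin_of_maps {α β δ : CuntzToeplitz n}
    (h : ∀ x y, δ.1.Maps x y ↔ α.1.Maps x y ∨ β.1.Maps x y) : IsJoin α β δ := by
  refine ⟨natLE_iff.2 fun x y hm => (h x y).2 (Or.inl hm),
    natLE_iff.2 fun x y hm => (h x y).2 (Or.inr hm), fun κ h1 h2 => natLE_iff.2 fun x y hm => ?_⟩
  exact ((h x y).1 hm).elim (natLE_iff.1 h1 x y) (natLE_iff.1 h2 x y)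

theorem exists_union {α β : CuntzToeplitz n} (hc : Compatible α β) :
    ∃ δ : CuntzToeplitz n, ∀ x y, δ.1.Maps x y ↔ α.1.Maps x y ∨ β.1.Maps x y := by
  obtain ⟨N, hN⟩ := exists_stable α
  obtain ⟨M, hM⟩ := exists_stable β
  refine ⟨ofRel (fun x y => α.1.Maps x y ∨ β.1.Maps x y) ?_ ⟨max N M, fun w hw z u => ?_⟩,
    fun x y => maps_ofRel⟩
  · rintro x y x' y' (h | h) (h' | h')
    · exact h.eq_iff h'
    · exact eq_iff_of_compatible hc h h'
    · exact eq_iff_of_compatible (isInverseSemigroup.compatible_comm hc) h h'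
    · exact h.eq_iff h'
  · rw [hN w (le_of_max_le_left hw), hM w (le_of_max_le_right hw), ← exists_or]
    simp only [or_and_right]

theorem maps_of_isJoin {α β δ : CuntzToeplitz n} (hc : Compatible α β) (h : IsJoin α β δ)
    (x y : List (Fin n)) : δ.1.Maps x y ↔ α.1.Maps x y ∨ β.1.Maps x y := by
  obtain ⟨δ', h'⟩ := exists_union hc
  rw [isInverseSemigroup.join_unique h (isJoin_of_maps h'), h']

theorem isDistributiveInverse : IsDistributiveInverse (CuntzToeplitz n) where
  inverse := isInverseSemigroup
  exists_join α β hc := by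
    obtain ⟨δ, h⟩ := exists_union hc
    exact ⟨δ, isJoin_of_maps h⟩
  mul_join α β δ κ hc h := isJoin_of_maps fun x y => by
    simp only [maps_mul, maps_of_isJoin hc h, or_and_right, exists_or]
  join_mul α β δ κ hc h := isJoin_of_maps fun x y => by
    simp only [maps_mul, maps_of_isJoin hc h, and_or_left, exists_or]

/-- Definite languages. -/
def Definite (L : Set (List (Fin n))) : Prop :=
  ∃ N : ℕ, ∀ w, N ≤ w.length → ∀ z, w ++ z ∈ L ↔ w ∈ L

theorem Definite.combine {L L' : Set (List (Fin n))} (h : Definite L) (h' : Definite L')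
    (p : Prop → Prop → Prop) : Definite {w | p (w ∈ L) (w ∈ L')} := by
  obtain ⟨N, hN⟩ := h
  obtain ⟨M, hM⟩ := h'
  refine ⟨max N M, fun w hw z => ?_⟩
  simp only [Set.mem_ofPred_eq, hN w (le_of_max_le_left hw) z, hM w (le_of_max_le_right hw) z]

/-- The identity of a definite language. -/
noncomputable def idOn (L : Set (List (Fin n))) (hL : Definite L) :
    {ε : CuntzToeplitz n // IsIdempotentElem ε} :=
  ⟨ofRel (fun x y => x ∈ L ∧ x = y) (by rintro x y x' y' ⟨-, rfl⟩ ⟨-, rfl⟩; rfl) (by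
    obtain ⟨N, hN⟩ := hL
    refine ⟨N, fun w hw z u => ?_⟩
    rw [hN w hw]
    constructor
    · rintro ⟨h, rfl⟩
      exact ⟨w, ⟨h, rfl⟩, rfl⟩
    · rintro ⟨y, ⟨h, rfl⟩, rfl⟩
      exact ⟨h, rfl⟩), isIdempotentElem_iff.2 fun x y h => (maps_ofRel.1 h).2⟩

/-- The language of which a given idempotent is the identity. -/
def fixed (ε : {ε : CuntzToeplitz n // IsIdempotentElem ε}) : Set (List (Fin n)) :=
  {x | ε.1.1.Maps x x}

theorem fixed_idOn (L : Set (List (Fin n))) (hL : Definite L) : fixed (idOn L hL) = L := by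
  ext x
  simp [fixed, idOn]

theorem definite_fixed (ε : {ε : CuntzToeplitz n // IsIdempotentElem ε}) :
    Definite (fixed ε) := by
  obtain ⟨N, hN⟩ := exists_stable ε.1
  refine ⟨N, fun w hw z => ?_⟩
  simp only [fixed, Set.mem_ofPred_eq, hN w hw]
  constructor
  · rintro ⟨y, hy, h⟩
    rwa [← List.append_cancel_right h] at hy
  · exact fun h => ⟨w, h, rfl⟩

theorem fixed_subset_iff {ε φ : {ε : CuntzToeplitz n // IsIdempotentElem ε}} :
    fixed ε ⊆ fixed φ ↔ NatLE ε.1 φ.1 := by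
  rw [natLE_iff]
  constructor
  · intro h x y hm
    obtain rfl := isIdempotentElem_iff.1 ε.2 x y hm
    exact h hm
  · exact fun h x hx => h x x hx

theorem fixed_injective : Function.Injective (fixed (n := n)) := fun _ _ h =>
  Subtype.ext (isInverseSemigroup.natLE_antisymm (fixed_subset_iff.1 h.le)
    (fixed_subset_iff.1 h.ge))

/-- The generalized Boolean algebra of idempotents. -/
noncomputable abbrev idempotentAlgebra :
    GeneralizedBooleanAlgebra {ε : CuntzToeplitz n // IsIdempotentElem ε} :=
  letI : LE {ε : CuntzToeplitz n // IsIdempotentElem ε} := ⟨fun ε φ => fixed ε ⊆ fixed φ⟩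
  letI : LT {ε : CuntzToeplitz n // IsIdempotentElem ε} := ⟨fun ε φ => fixed ε ⊂ fixed φ⟩
  letI : Max {ε : CuntzToeplitz n // IsIdempotentElem ε} :=
    ⟨fun ε φ => idOn _ ((definite_fixed ε).combine (definite_fixed φ) Or)⟩
  letI : Min {ε : CuntzToeplitz n // IsIdempotentElem ε} :=
    ⟨fun ε φ => idOn _ ((definite_fixed ε).combine (definite_fixed φ) And)⟩
  letI : SDiff {ε : CuntzToeplitz n // IsIdempotentElem ε} :=
    ⟨fun ε φ => idOn _ ((definite_fixed ε).combine (definite_fixed φ) fun p q => p ∧ ¬ q)⟩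
  letI : Bot {ε : CuntzToeplitz n // IsIdempotentElem ε} := ⟨⟨0, isIdempotentElem_zero⟩⟩
  -- The structure is pulled back along `fixed` from the algebra of all subsets of A*, whose
  -- operations preserve definite languages.
  fixed_injective.generalizedBooleanAlgebra fixed Iff.rfl Iff.rfl
    (fun _ _ => fixed_idOn _ _) (fun _ _ => fixed_idOn _ _)
    (Set.eq_empty_of_forall_notMem fun _ => not_maps_zero) (fun _ _ => fixed_idOn _ _)

theorem isBooleanInverse : IsBooleanInverse (CuntzToeplitz n) where
  toIsDistributiveInverse := isDistributiveInverse
  boolean := ⟨idempotentAlgebra, fun _ _ => fixed_subset_iff⟩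

end CuntzToeplitz
-- Normal forms in the polycyclic monoid
namespace Polycyclic

variable {n : ℕ}

theorem mk_zero : (mk 0 : Polycyclic n) = 0 := rfl

theorem genInv_mul_gen (i : Fin n) : genInv i * gen i = 1 :=
  (map_mul mk _ _).symm.trans ((Con.eq _).2 (.of _ _ (.same i)))

theorem genInv_mul_gen_of_ne {i j : Fin n} (h : i ≠ j) : genInv i * gen j = 0 :=
  (map_mul mk _ _).symm.trans ((Con.eq _).2 (.of _ _ (.diff i j h)))

/-- The product `aᵢ₁ ⋯ aᵢₖ`. -/
def word : List (Fin n) → Polycyclic n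
  | [] => 1
  | i :: x => gen i * word x

/-- The inverse of the product `aᵢ₁ ⋯ aᵢₖ`. -/
def wordInv : List (Fin n) → Polycyclic n
  | [] => 1
  | i :: x => wordInv x * genInv i

@[simp] theorem word_nil : word (n := n) [] = 1 := rfl

@[simp] theorem wordInv_nil : wordInv (n := n) [] = 1 := rfl

theorem word_append (x y : List (Fin n)) : word (x ++ y) = word x * word y := by
  induction x with
  | nil => simp
  | cons i x ih => simp [word, ih, mul_assoc]

theorem wordInv_append (x y : List (Fin n)) : wordInv (x ++ y) = wordInv y * wordInv x := by
  induction x with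
  | nil => simp
  | cons i x ih => simp [wordInv, ih, mul_assoc]

theorem wordInv_mul_word (x : List (Fin n)) : wordInv x * word x = 1 := by
  induction x with
  | nil => simp
  | cons i x ih =>
    rw [wordInv, word, mul_assoc, ← mul_assoc (genInv i), genInv_mul_gen, one_mul, ih]

theorem wordInv_mul_word_append (x z : List (Fin n)) : wordInv x * word (x ++ z) = word z := by
  rw [word_append, ← mul_assoc, wordInv_mul_word, one_mul]

theorem wordInv_append_mul_word (x z : List (Fin n)) :
    wordInv (x ++ z) * word x = wordInv z := by
  rw [wordInv_append, mul_assoc, wordInv_mul_word, mul_one]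

theorem wordInv_mul_word_of_not_prefix {x y : List (Fin n)} (h : ¬ x <+: y) (h' : ¬ y <+: x) :
    wordInv x * word y = 0 := by
  induction x generalizing y with
  | nil => simp at h
  | cons i x ih =>
    cases y with
    | nil => simp at h'
    | cons j y =>
      rw [wordInv, word, mul_assoc, ← mul_assoc (genInv i)]
      by_cases hij : i = j
      · subst hij
        rw [List.cons_prefix_cons] at h h'
        rw [genInv_mul_gen, one_mul, ih (by simpa using h) (by simpa using h')]
      · rw [genInv_mul_gen_of_ne hij, zero_mul, mul_zero]

/-- Left multiplication by a letter preserves this form: aᵢ lengthens x, while aᵢ⁻¹ cancels the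
first letter of x or gives zero or, if x is empty, lengthens y at its end. -/
theorem eq_zero_or_eq_word_mul (s : Polycyclic n) :
    s = 0 ∨ ∃ x y, s = word x * wordInv y := by
  obtain ⟨w, rfl⟩ := mk_surjective s
  induction w using WithZero.recZeroCoe with
  | zero => exact Or.inl mk_zero
  | coe w =>
    induction w using FreeMonoid.inductionOn' with
    | one => exact Or.inr ⟨[], [], by simp⟩
    | of_mul c w ih =>
      have hc : mk ((FreeMonoid.of c * w : FreeMonoid (Fin n ⊕ Fin n)) : PolyWord n) =
          mk (polyLetter c) * mk (w : PolyWord n) := by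
        rw [WithZero.coe_mul, map_mul]; rfl
      rw [hc]
      rcases ih with ih | ⟨x, y, ih⟩
      · left
        rw [ih, mul_zero]
      · rw [ih, ← mul_assoc]
        rcases c with i | i
        · exact Or.inr ⟨i :: x, y, rfl⟩
        · cases x with
          | nil => exact Or.inr ⟨[], y ++ [i], by simp [wordInv_append, wordInv, genInv]⟩
          | cons j x =>
            change genInv i * (gen j * word x) * _ = 0 ∨ ∃ x' y', genInv i * (gen j * word x) * _ = _
            rw [← mul_assoc (genInv i)]
            by_cases hij : i = j
            · subst hij
              rw [genInv_mul_gen, one_mul]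
              exact Or.inr ⟨x, y, rfl⟩
            · left
              rw [genInv_mul_gen_of_ne hij, zero_mul, zero_mul]

end Polycyclic

/-! ### Cylinder maps and one-point maps -/

namespace CuntzToeplitz

variable {n : ℕ}

theorem cyl_rel_append (x y w : List (Fin n)) (hw : y.length ≤ w.length) (z u : List (Fin n)) :
    (∃ t, w ++ z = y ++ t ∧ u = x ++ t) ↔ ∃ v, (∃ t, w = y ++ t ∧ v = x ++ t) ∧ u = v ++ z := by
  constructor
  · rintro ⟨t, ht, rfl⟩
    obtain ⟨s, rfl⟩ := List.prefix_of_prefix_length_le (ht ▸ List.prefix_append y t)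
      (List.prefix_append w z) hw
    rw [List.append_assoc, List.append_cancel_left_eq] at ht
    exact ⟨x ++ s, ⟨s, rfl, rfl⟩, by simp [← ht]⟩
  · rintro ⟨_, ⟨t, rfl, rfl⟩, rfl⟩
    exact ⟨t ++ z, by simp⟩

/-- The map `yA* → xA*`, `yz ↦ xz`. -/
noncomputable def cyl (x y : List (Fin n)) : CuntzToeplitz n :=
  ofRel (fun u v => ∃ z, u = y ++ z ∧ v = x ++ z)
    (by rintro _ _ _ _ ⟨z, rfl, rfl⟩ ⟨z', rfl, rfl⟩; simp) ⟨y.length, cyl_rel_append x y⟩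

theorem maps_cyl {x y u v : List (Fin n)} :
    (cyl x y).1.Maps u v ↔ ∃ z, u = y ++ z ∧ v = x ++ z := maps_ofRel

theorem stable_cyl (x y : List (Fin n)) : Stable (cyl x y).1 y.length := by
  intro w hw z u
  simpa only [maps_cyl] using cyl_rel_append x y w hw z u

/-- The map `{y} → {x}`. -/
noncomputable def pt (x y : List (Fin n)) : CuntzToeplitz n :=
  ofRel (fun u v => u = y ∧ v = x)
    -- The bound must exceed |y|: y is in the domain, but no proper extension of it is.
    (by rintro _ _ _ _ ⟨rfl, rfl⟩ ⟨rfl, rfl⟩; simp) ⟨y.length + 1, fun w hw z u => by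
      constructor
      · rintro ⟨rfl, rfl⟩
        simp at hw
      · rintro ⟨_, ⟨rfl, rfl⟩, rfl⟩
        simp at hw⟩

theorem maps_pt {x y u v : List (Fin n)} : (pt x y).1.Maps u v ↔ u = y ∧ v = x := maps_ofRel

end CuntzToeplitz

/-! ### The embedding of Pₙ into CT(A*) -/

namespace Polycyclic

open CuntzToeplitz

variable {n : ℕ}

/-- The images of the letters. -/
noncomputable def letterMap : Fin n ⊕ Fin n → CuntzToeplitz n
  | Sum.inl i => cyl [i] []
  | Sum.inr i => cyl [] [i]

/-- The map from words with zero. -/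
noncomputable def wordMap (n : ℕ) : PolyWord n →*₀ CuntzToeplitz n :=
  WithZero.lift' (FreeMonoid.lift letterMap)

theorem wordMap_letter (c : Fin n ⊕ Fin n) : wordMap n (polyLetter c) = letterMap c := by
  simp [wordMap, polyLetter]

theorem conGen_le_ker (n : ℕ) :
    conGen (PolyRel n) ≤ Con.ker ((wordMap n : PolyWord n →* CuntzToeplitz n)) := by
  rw [Con.conGen_le]
  rintro _ _ (i | ⟨i, j, hij⟩)
  · rw [Con.ker_rel, MonoidHom.coe_coe]
    rw [map_mul, map_one, wordMap_letter, wordMap_letter]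
    refine CuntzToeplitz.ext_maps fun x y => ?_
    simp only [CuntzToeplitz.maps_mul, letterMap, maps_cyl, CuntzToeplitz.maps_one]
    simp [eq_comm]
  · rw [Con.ker_rel, MonoidHom.coe_coe]
    rw [map_mul, map_zero, wordMap_letter, wordMap_letter]
    refine CuntzToeplitz.ext_maps fun x y => ?_
    simp only [CuntzToeplitz.maps_mul, letterMap, maps_cyl, CuntzToeplitz.not_maps_zero]
    simp [hij.symm]

/-- The embedding of `Pₙ` into `CT(A*)`. -/
noncomputable def toCT (n : ℕ) : Polycyclic n →*₀ CuntzToeplitz n :=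
  { Con.lift _ _ (conGen_le_ker n) with
    map_zero' := map_zero (wordMap n) }

theorem toCT_gen (i : Fin n) : toCT n (gen i) = cyl [i] [] := wordMap_letter (Sum.inl i)

theorem toCT_genInv (i : Fin n) : toCT n (genInv i) = cyl [] [i] := wordMap_letter (Sum.inr i)

theorem toCT_word (x : List (Fin n)) : toCT n (word x) = cyl x [] := by
  induction x with
  | nil => exact (map_one _).trans (CuntzToeplitz.ext_maps fun x y => by
      simp [CuntzToeplitz.maps_one, maps_cyl, eq_comm])
  | cons i x ih =>
    rw [word, map_mul, toCT_gen, ih]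
    exact CuntzToeplitz.ext_maps fun x y => by simp [CuntzToeplitz.maps_mul, maps_cyl]

theorem toCT_wordInv (x : List (Fin n)) : toCT n (wordInv x) = cyl [] x := by
  induction x with
  | nil => exact (map_one _).trans (CuntzToeplitz.ext_maps fun x y => by
      simp [CuntzToeplitz.maps_one, maps_cyl, eq_comm])
  | cons i x ih =>
    rw [wordInv, map_mul, toCT_genInv, ih]
    exact CuntzToeplitz.ext_maps fun x y => by simp [CuntzToeplitz.maps_mul, maps_cyl]

theorem toCT_word_mul (x y : List (Fin n)) : toCT n (word x * wordInv y) = cyl x y := by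
  rw [map_mul, toCT_word, toCT_wordInv]
  exact CuntzToeplitz.ext_maps fun u v => by simp [CuntzToeplitz.maps_mul, maps_cyl, and_comm]

theorem cyl_injective {x y x' y' : List (Fin n)} (h : cyl x y = cyl x' y') :
    x = x' ∧ y = y' := by
  have h1 : (cyl x' y').1.Maps y x := h ▸ maps_cyl.2 ⟨[], by simp⟩
  have h2 : (cyl x y).1.Maps y' x' := h ▸ maps_cyl.2 ⟨[], by simp⟩
  obtain ⟨z, rfl, rfl⟩ := maps_cyl.1 h1
  obtain ⟨z', h3, -⟩ := maps_cyl.1 h2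
  simp at h3
  simp [h3]

theorem cyl_ne_zero (x y : List (Fin n)) : cyl x y ≠ 0 := fun h =>
  CuntzToeplitz.not_maps_zero (x := y) (y := x) (h ▸ maps_cyl.2 ⟨[], by simp⟩)

theorem toCT_injective : Function.Injective (toCT n) := by
  intro s t h
  rcases eq_zero_or_eq_word_mul s with rfl | ⟨x, y, rfl⟩ <;>
    rcases eq_zero_or_eq_word_mul t with rfl | ⟨x', y', rfl⟩
  · rfl
  · rw [map_zero, toCT_word_mul] at h
    exact (cyl_ne_zero _ _ h.symm).elim
  · rw [map_zero, toCT_word_mul] at h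
    exact (cyl_ne_zero _ _ h).elim
  · rw [toCT_word_mul, toCT_word_mul] at h
    obtain ⟨rfl, rfl⟩ := cyl_injective h
    rfl

theorem isInverseOf_word (x y : List (Fin n)) :
    IsInverseOf (word x * wordInv y) (word y * wordInv x) := by
  constructor <;>
  · simp only [mul_assoc]
    rw [← mul_assoc (wordInv _) (word _) (wordInv _), wordInv_mul_word, one_mul,
      ← mul_assoc (wordInv _) (word _) (wordInv _), wordInv_mul_word, one_mul]

/-- Existence comes from the normal form; uniqueness is inherited from CT(A*) through the embedding.
-/
theorem isInverseSemigroup : IsInverseSemigroup (Polycyclic n) := by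
  intro s
  have hu : ∀ t t', IsInverseOf s t → IsInverseOf s t' → t = t' := by
    have hf : IsZeroHom (toCT n) := ⟨map_mul _, map_zero _⟩
    exact fun t t' h h' => toCT_injective
      (CuntzToeplitz.isInverseSemigroup.eq_of_inverse (hf.isInverseOf h) (hf.isInverseOf h'))
  rcases eq_zero_or_eq_word_mul s with rfl | ⟨x, y, rfl⟩
  · exact ⟨0, .of_idem isIdempotentElem_zero,
      fun t h => hu t 0 h (.of_idem isIdempotentElem_zero)⟩
  · exact ⟨_, isInverseOf_word x y, fun t h => hu t _ h (isInverseOf_word x y)⟩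

end Polycyclic

open Polycyclic

section JoinSets

variable {S : Type*} [SemigroupWithZero S]

/-- Zero lies below everything, so it does not affect a join. This is needed because multiplying a
family of pieces by an element annihilates some of them. -/
theorem IsInverseSemigroup.joinSet_eq (hS : IsInverseSemigroup S) {F G : Set S} {j k : S}
    (hF : IsJoinSet F j) (hG : IsJoinSet G k) (h : ∀ s ∈ F, s = 0 ∨ s ∈ G)
    (h' : ∀ s ∈ G, s = 0 ∨ s ∈ F) : j = k := by
  refine hS.natLE_antisymm (hF.2 k fun s hs => ?_) (hG.2 j fun s hs => ?_)
  · rcases h s hs with rfl | hs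
    · exact zero_natLE _
    · exact hG.1 s hs
  · rcases h' s hs with rfl | hs
    · exact zero_natLE _
    · exact hF.1 s hs

theorem IsInverseSemigroup.joinSet_eq_of_unique (hS : IsInverseSemigroup S) {F : Set S} {a j : S}
    (hF : IsJoinSet F j) (h : ∀ s ∈ F, s = 0 ∨ s = a) (h' : a = 0 ∨ a ∈ F) : j = a :=
  hS.joinSet_eq hF (hS.isJoinSet_singleton a) h (by rintro s rfl; exact h')

end JoinSets

/-! ### The complement d, and the pieces of a permissible bijection -/

/-- A homomorphism `θ` from `Pₙ`, and an idempotent `d` which is the complement in `θ(1)` of the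
join of the `θ(aᵢaᵢ⁻¹)`. -/
structure IsComplemented {n : ℕ} {T : Type*} [SemigroupWithZero T] (θ : Polycyclic n → T)
    (d : T) : Prop extends IsZeroHom θ where
  idem : d * d = d
  one_mul : θ 1 * d = d
  mul_gen : ∀ i, d * θ (gen i) = 0
  genInv_mul : ∀ i, θ (genInv i) * d = 0
  join : CompatJoin (insert d (Set.range fun i => θ (gen i * genInv i))) (θ 1)

/-- The complement from `exists_compl` is orthogonal to every θ(aᵢaᵢ⁻¹); the factorizations aᵢ =
(aᵢaᵢ⁻¹)aᵢ and aᵢ⁻¹ = aᵢ⁻¹(aᵢaᵢ⁻¹) turn this into dθ(aᵢ) = 0 = θ(aᵢ⁻¹)d. -/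
theorem IsBooleanInverse.exists_isComplemented {n : ℕ} {T : Type*} [SemigroupWithZero T]
    (hT : IsBooleanInverse T) {θ : Polycyclic n → T} (hθ : IsZeroHom θ) :
    ∃ d, IsComplemented θ d := by
  have h1 : IsIdempotentElem (θ 1) := hθ.isIdempotentElem (mul_one 1)
  have hi : ∀ i : Fin n, gen i * genInv i * (gen i * genInv i) = gen i * genInv i := fun i => by
    rw [mul_assoc, ← mul_assoc (genInv i), genInv_mul_gen, one_mul]
  have hi' : ∀ i : Fin n, IsIdempotentElem (θ (gen i * genInv i)) := fun i =>
    hθ.isIdempotentElem (hi i)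
  obtain ⟨d, hd, h1d, hd0, hj⟩ := hT.exists_compl h1
    (G := Set.range fun i => θ (gen i * genInv i)) (Set.finite_range _)
    (by rintro _ ⟨i, rfl⟩; exact hi' i)
    (by rintro _ ⟨i, rfl⟩; exact ⟨_, hi' i, by rw [← hθ.map_mul, _root_.one_mul]⟩)
  refine ⟨d, hθ, hd, h1d, fun i => ?_, fun i => ?_, hj⟩
  · have : gen i = gen i * genInv i * gen i := by
      rw [mul_assoc, genInv_mul_gen, mul_one]
    rw [this, hθ.map_mul, ← mul_assoc, hd0 _ ⟨i, rfl⟩, zero_mul]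
  · have : genInv i = genInv i * (gen i * genInv i) := by
      rw [← mul_assoc, genInv_mul_gen, _root_.one_mul]
    rw [this, hθ.map_mul, mul_assoc, hT.inverse.idem_comm (hi' i) hd, hd0 _ ⟨i, rfl⟩, mul_zero]

section Extension

variable {n : ℕ} {T : Type*} [SemigroupWithZero T]

/-- The element that corresponds to `{y} → {x}`. -/
def ptElem (θ : Polycyclic n → T) (d : T) (x y : List (Fin n)) : T :=
  θ (word x) * d * θ (wordInv y)

/-- The element that corresponds to `yA* → xA*`. -/
def cylElem (θ : Polycyclic n → T) (x y : List (Fin n)) : T := θ (word x * wordInv y)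

/-- The pieces into which `α` is cut by the words of length up to `N`. -/
def pieces (θ : Polycyclic n → T) (d : T) (N : ℕ) (α : CuntzToeplitz n) : Set T :=
  {t | ∃ x y, α.1.Maps x y ∧
    ((x.length < N ∧ t = ptElem θ d y x) ∨ (x.length = N ∧ t = cylElem θ y x))}

theorem pieces_finite (θ : Polycyclic n → T) (d : T) (N : ℕ) (α : CuntzToeplitz n) :
    (pieces θ d N α).Finite := by
  refine ((List.finite_length_le (Fin n) N).biUnion
    (t := fun x => {t | ∃ y, α.1.Maps x y ∧ (t = ptElem θ d y x ∨ t = cylElem θ y x)})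
    fun x _ => ?_).subset ?_
  · by_cases h : ∃ y, α.1.Maps x y
    · obtain ⟨y, hy⟩ := h
      refine Set.Finite.subset (Set.toFinite {ptElem θ d y x, cylElem θ y x}) ?_
      rintro t ⟨y', hy', ht⟩
      obtain rfl := hy.right_unique hy'
      exact ht
    · refine Set.finite_empty.subset ?_
      rintro t ⟨y, hy, -⟩
      exact h ⟨y, hy⟩
  · rintro t ⟨x, y, h, ⟨hx, ht⟩ | ⟨hx, ht⟩⟩
    · exact Set.mem_biUnion (x := x) hx.le ⟨y, h, Or.inl ht⟩
    · exact Set.mem_biUnion (x := x) hx.le ⟨y, h, Or.inr ht⟩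

namespace IsComplemented

variable {θ : Polycyclic n → T} {d : T} (hd : IsComplemented θ d)
include hd

/-! ### Multiplication table of point and cylinder elements -/

theorem mul_word {z : List (Fin n)} (hz : z ≠ []) : d * θ (word z) = 0 := by
  obtain ⟨i, z, rfl⟩ := List.exists_cons_of_ne_nil hz
  rw [word, hd.map_mul, ← mul_assoc, hd.mul_gen, zero_mul]

theorem wordInv_mul {z : List (Fin n)} (hz : z ≠ []) : θ (wordInv z) * d = 0 := by
  obtain ⟨i, z, rfl⟩ := List.exists_cons_of_ne_nil hz
  rw [wordInv, hd.map_mul, mul_assoc, hd.genInv_mul, mul_zero]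

theorem cyl_mul_cyl_append (x y z v : List (Fin n)) :
    cylElem θ x y * cylElem θ (y ++ z) v = cylElem θ (x ++ z) v := by
  rw [cylElem, cylElem, cylElem, ← hd.map_mul, mul_assoc, ← mul_assoc (wordInv y),
    wordInv_mul_word_append, ← mul_assoc, ← word_append]

theorem cyl_mul_cyl (x y v : List (Fin n)) : cylElem θ x y * cylElem θ y v = cylElem θ x v := by
  simpa using hd.cyl_mul_cyl_append x y [] v

theorem cyl_mul_cyl_eq_zero {y u : List (Fin n)} (h : ¬ y <+: u) (h' : ¬ u <+: y)
    (x v : List (Fin n)) : cylElem θ x y * cylElem θ u v = 0 := by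
  rw [cylElem, cylElem, ← hd.map_mul, mul_assoc, ← mul_assoc (wordInv y),
    wordInv_mul_word_of_not_prefix h h', zero_mul, mul_zero, hd.map_zero]

/-- If u is a proper prefix of y, then y⁻¹u is the inverse of a nonempty word, which d annihilates;
if u and y are incomparable, y⁻¹u is already zero in Pₙ. -/
theorem cyl_mul_pt_eq_zero {y u : List (Fin n)} (h : ¬ y <+: u) (x v : List (Fin n)) :
    cylElem θ x y * ptElem θ d u v = 0 := by
  rw [cylElem, ptElem, ← mul_assoc, ← mul_assoc, ← hd.map_mul, mul_assoc (word x)]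
  by_cases h' : u <+: y
  · obtain ⟨z, rfl⟩ := h'
    have hz : z ≠ [] := by rintro rfl; simp at h
    rw [wordInv_append_mul_word, hd.map_mul, mul_assoc _ _ d, hd.wordInv_mul hz, mul_zero,
      zero_mul]
  · rw [wordInv_mul_word_of_not_prefix h h', mul_zero, hd.map_zero, zero_mul, zero_mul]

theorem pt_mul_cyl_eq_zero {y u : List (Fin n)} (h : ¬ u <+: y) (x v : List (Fin n)) :
    ptElem θ d x y * cylElem θ u v = 0 := by
  rw [cylElem, ptElem, mul_assoc, ← hd.map_mul, ← mul_assoc (wordInv y)]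
  by_cases h' : y <+: u
  · obtain ⟨z, rfl⟩ := h'
    have hz : z ≠ [] := by rintro rfl; simp at h
    rw [wordInv_mul_word_append, hd.map_mul, mul_assoc, ← mul_assoc d, hd.mul_word hz, zero_mul,
      mul_zero]
  · rw [wordInv_mul_word_of_not_prefix h' h, zero_mul, hd.map_zero, mul_zero]

theorem pt_mul_pt (x y v : List (Fin n)) :
    ptElem θ d x y * ptElem θ d y v = ptElem θ d x v := by
  have : θ (word x) * d * θ (wordInv y) * (θ (word y) * d * θ (wordInv v)) =
      θ (word x) * (d * θ (wordInv y * word y) * d) * θ (wordInv v) := by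
    rw [hd.map_mul]; simp only [mul_assoc]
  rw [ptElem, ptElem, ptElem, this, wordInv_mul_word, mul_assoc d, hd.one_mul, hd.idem]

/-- One of the distinct words y, u is not a prefix of the other. Accordingly θ(y⁻¹) annihilates the
point element on its right, or θ(u) the one on its left. -/
theorem pt_mul_pt_eq_zero {y u : List (Fin n)} (h : y ≠ u) (x v : List (Fin n)) :
    ptElem θ d x y * ptElem θ d u v = 0 := by
  by_cases hu : u <+: y
  · have hy : ¬ y <+: u := fun hy => h (hy.eq_of_length_le hu.length_le)
    have := hd.cyl_mul_pt_eq_zero hy [] v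
    rw [cylElem, word_nil, _root_.one_mul] at this
    rw [ptElem, mul_assoc, this, mul_zero]
  · have := hd.pt_mul_cyl_eq_zero hu x []
    rw [cylElem, wordInv_nil, mul_one] at this
    rw [ptElem.eq_def θ d u v, ← mul_assoc, ← mul_assoc, this, zero_mul, zero_mul]

theorem isInverseOf_cyl (x y : List (Fin n)) : IsInverseOf (cylElem θ x y) (cylElem θ y x) :=
  ⟨by rw [hd.cyl_mul_cyl, hd.cyl_mul_cyl], by rw [hd.cyl_mul_cyl, hd.cyl_mul_cyl]⟩

theorem isInverseOf_pt (x y : List (Fin n)) : IsInverseOf (ptElem θ d x y) (ptElem θ d y x) :=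
  ⟨by rw [hd.pt_mul_pt, hd.pt_mul_pt], by rw [hd.pt_mul_pt, hd.pt_mul_pt]⟩

/-! ### The join of the pieces -/

/-- Distinct pieces are orthogonal on both sides. Their domains are disjoint by the choice of
lengths; their images are disjoint because stability and injectivity let a prefix relation between
images be pulled back when the shorter source word has length at least N (`hpre`). -/
theorem compatible_pieces (hT : IsInverseSemigroup T) {N : ℕ} {α : CuntzToeplitz n}
    (hα : Stable α.1 N) :
    ∀ s ∈ pieces θ d N α, ∀ t ∈ pieces θ d N α, Compatible s t := by
  have hc0 : ∀ {s s' t t' : T}, IsInverseOf s s' → IsInverseOf t t' → s' * t = 0 → s * t' = 0 →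
      Compatible s t := fun hs ht h h' =>
    ⟨_, _, hs, ht, h ▸ isIdempotentElem_zero, h' ▸ isIdempotentElem_zero⟩
  have hpre : ∀ {v x w y : List (Fin n)}, N ≤ v.length → α.1.Maps v x → α.1.Maps w y → x <+: y →
      v <+: w := by
    rintro v x w y hv hx hy ⟨z, rfl⟩
    exact ⟨z, ((hα v hv z _).2 ⟨x, hx, rfl⟩).left_unique hy⟩
  have hpt : ∀ {v x w y : List (Fin n)}, w.length < N → v.length = N → α.1.Maps v x →
      α.1.Maps w y → Compatible (cylElem θ x v) (ptElem θ d y w) := by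
    intro v x w y hw hv hx hy
    have hvw : ¬ v <+: w := fun h => by
      have := h.length_le
      omega
    exact hc0 (hd.isInverseOf_cyl x v) (hd.isInverseOf_pt y w)
      (hd.cyl_mul_pt_eq_zero (fun h => hvw (hpre hv.ge hx hy h)) _ _)
      (hd.cyl_mul_pt_eq_zero hvw _ _)
  rintro s ⟨v, x, hx, ⟨hv, rfl⟩ | ⟨hv, rfl⟩⟩ t ⟨w, y, hy, ⟨hw, rfl⟩ | ⟨hw, rfl⟩⟩
  · by_cases hvw : v = w
    · subst hvw
      obtain rfl := hx.right_unique hy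
      exact hT.compatible_refl _
    · exact hc0 (hd.isInverseOf_pt x v) (hd.isInverseOf_pt y w)
        (hd.pt_mul_pt_eq_zero (fun h => hvw ((hx.eq_iff hy).2 h)) _ _)
        (hd.pt_mul_pt_eq_zero hvw _ _)
  · exact hT.compatible_comm (hpt hv hw hy hx)
  · exact hpt hw hv hx hy
  · by_cases hvw : v = w
    · subst hvw
      obtain rfl := hx.right_unique hy
      exact hT.compatible_refl _
    · have h1 : ¬ v <+: w := fun h => hvw (h.eq_of_length (hv.trans hw.symm))
      have h2 : ¬ w <+: v := fun h => hvw (h.eq_of_length (hw.trans hv.symm)).symm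
      exact hc0 (hd.isInverseOf_cyl x v) (hd.isInverseOf_cyl y w)
        (hd.cyl_mul_cyl_eq_zero (fun h => h1 (hpre hv.ge hx hy h))
          (fun h => h2 (hpre hw.ge hy hx h)) _ _)
        (hd.cyl_mul_cyl_eq_zero h1 h2 _ _)

theorem exists_compatJoin_pieces (hT : IsDistributiveInverse T) {N : ℕ} {α : CuntzToeplitz n}
    (hα : Stable α.1 N) : ∃ t, CompatJoin (pieces θ d N α) t :=
  hT.exists_compatJoin (pieces_finite θ d N α) (hd.compatible_pieces hT.inverse hα)

/-- This is the equation expressing θ(1) as the join of d and the θ(aᵢaᵢ⁻¹), multiplied by θ(x) on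
the left and θ(y⁻¹) on the right: a cylinder splits into its vertex and its n children. -/
theorem isJoinSet_cyl (hT : IsDistributiveInverse T) (x y : List (Fin n)) :
    IsJoinSet (insert (ptElem θ d x y) (Set.range fun i => cylElem θ (x ++ [i]) (y ++ [i])))
      (cylElem θ x y) := by
  have h := hd.join.mul_mul hT (θ (word x)) (θ (wordInv y))
  rw [← hd.map_mul, ← hd.map_mul, mul_one, Set.image_insert_eq, ← Set.range_comp] at h
  have e : (fun i => cylElem θ (x ++ [i]) (y ++ [i])) =
      (fun s => θ (word x) * s * θ (wordInv y)) ∘ fun i => θ (gen i * genInv i) := by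
    funext i
    simp only [cylElem, Function.comp, ← hd.map_mul, word_append, wordInv_append, word, wordInv,
      mul_one, _root_.one_mul, mul_assoc]
  rw [e]
  exact h

/-- Passing to N + 1 splits each cylinder piece as in `isJoinSet_cyl` and leaves the points alone;
by stability the children are exactly the new cylinder pieces. -/
theorem isJoinSet_pieces_succ (hT : IsDistributiveInverse T) {N : ℕ} {α : CuntzToeplitz n}
    (hα : Stable α.1 N) {t : T} (h : IsJoinSet (pieces θ d N α) t) :
    IsJoinSet (pieces θ d (N + 1) α) t := by
  constructor
  · rintro s ⟨x, y, hxy, ⟨hx, rfl⟩ | ⟨hx, rfl⟩⟩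
    · rcases Nat.lt_succ_iff_lt_or_eq.1 hx with hx | hx
      · exact h.1 _ ⟨x, y, hxy, Or.inl ⟨hx, rfl⟩⟩
      · exact hT.inverse.natLE_trans ((hd.isJoinSet_cyl hT y x).1 _ (Set.mem_insert _ _))
          (h.1 _ ⟨x, y, hxy, Or.inr ⟨hx, rfl⟩⟩)
    · obtain ⟨w, i, rfl⟩ : ∃ w i, x = w ++ [i] := by
        rcases List.eq_nil_or_concat' x with rfl | ⟨w, i, rfl⟩
        · simp at hx
        · exact ⟨w, i, rfl⟩
      have hw : w.length = N := by simpa using hx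
      obtain ⟨v, hv, rfl⟩ := (hα w hw.ge [i] y).1 hxy
      exact hT.inverse.natLE_trans
        ((hd.isJoinSet_cyl hT v w).1 _ (Set.mem_insert_of_mem _ ⟨i, rfl⟩))
        (h.1 _ ⟨w, v, hv, Or.inr ⟨hw, rfl⟩⟩)
  · intro k hk
    refine h.2 k ?_
    rintro s ⟨x, y, hxy, ⟨hx, rfl⟩ | ⟨hx, rfl⟩⟩
    · exact hk _ ⟨x, y, hxy, Or.inl ⟨by omega, rfl⟩⟩
    · refine (hd.isJoinSet_cyl hT y x).2 k ?_
      rintro s (rfl | ⟨i, rfl⟩)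
      · exact hk _ ⟨x, y, hxy, Or.inl ⟨by omega, rfl⟩⟩
      · exact hk _ ⟨x ++ [i], y ++ [i], (hα x hx.ge [i] _).2 ⟨y, hxy, rfl⟩,
          Or.inr ⟨by simp [hx], rfl⟩⟩

/-- One value serves every stable cut, so later computations may cut at whatever length suits them.
-/
theorem exists_extension (hT : IsDistributiveInverse T) : ∃ γ : CuntzToeplitz n → T,
    ∀ α N, Stable α.1 N → CompatJoin (pieces θ d N α) (γ α) := by
  have : ∀ α : CuntzToeplitz n, ∃ t, ∀ N, Stable α.1 N → CompatJoin (pieces θ d N α) t := by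
    intro α
    classical
    have hex := α.exists_stable
    obtain ⟨t, ht⟩ := hd.exists_compatJoin_pieces hT (Nat.find_spec hex)
    refine ⟨t, fun N hN => hT.compatJoin_of_isJoinSet (pieces_finite θ d N α)
      (hd.compatible_pieces hT.inverse hN) ?_⟩
    induction N, Nat.find_min' hex hN using Nat.le_induction with
    | base => exact ht.isJoinSet hT.inverse
    | succ M hM ih =>
      have hM' := (Nat.find_spec hex).mono hM
      exact hd.isJoinSet_pieces_succ hT hM' (ih hM')
  choose γ hγ using this
  exact ⟨γ, hγ⟩

/-! ### The extension is a morphism that extends θ -/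

variable {γ : CuntzToeplitz n → T}
  (hγ : ∀ α N, Stable α.1 N → CompatJoin (pieces θ d N α) (γ α))
include hγ

/-- With α cut at length |x|, only the cylinder piece at x itself can have a nonzero product with
the given element. -/
theorem extension_mul_cyl (hT : IsDistributiveInverse T) {α : CuntzToeplitz n} {N : ℕ}
    (hα : Stable α.1 N) {x : List (Fin n)} (hx : N ≤ x.length) (w : List (Fin n)) :
    (∀ b, α.1.Maps x b → γ α * cylElem θ x w = cylElem θ b w) ∧
      ((¬ ∃ b, α.1.Maps x b) → γ α * cylElem θ x w = 0) := by
  have h := (hγ α _ (hα.mono hx)).mul_right hT (cylElem θ x w)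
  have key : ∀ s ∈ pieces θ d x.length α, s * cylElem θ x w = 0 ∨
      ∃ b, α.1.Maps x b ∧ s * cylElem θ x w = cylElem θ b w := by
    rintro s ⟨v, b, hvb, ⟨hv, rfl⟩ | ⟨hv, rfl⟩⟩
    · exact Or.inl (hd.pt_mul_cyl_eq_zero (fun h => by have := h.length_le; omega) _ _)
    · by_cases hvx : v = x
      · subst hvx
        exact Or.inr ⟨b, hvb, hd.cyl_mul_cyl _ _ _⟩
      · exact Or.inl (hd.cyl_mul_cyl_eq_zero (fun h => hvx (h.eq_of_length hv))
          (fun h => hvx (h.eq_of_length hv.symm).symm) _ _)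
  constructor
  · intro b hb
    refine hT.inverse.joinSet_eq_of_unique h ?_ (Or.inr ?_)
    · rintro _ ⟨s, hs, rfl⟩
      refine (key s hs).imp_right ?_
      rintro ⟨b', hb', h⟩
      rwa [hb.right_unique hb']
    · exact ⟨_, ⟨x, b, hb, Or.inr ⟨rfl, rfl⟩⟩, hd.cyl_mul_cyl _ _ _⟩
  · intro hb
    refine hT.inverse.joinSet_eq_of_unique h ?_ (Or.inl rfl)
    rintro _ ⟨s, hs, rfl⟩
    refine (key s hs).imp_right ?_
    rintro ⟨b', hb', h⟩
    exact (hb ⟨b', hb'⟩).elim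

theorem extension_mul_pt (hT : IsDistributiveInverse T) (α : CuntzToeplitz n)
    (x w : List (Fin n)) :
    (∀ b, α.1.Maps x b → γ α * ptElem θ d x w = ptElem θ d b w) ∧
      ((¬ ∃ b, α.1.Maps x b) → γ α * ptElem θ d x w = 0) := by
  obtain ⟨N, hN⟩ := α.exists_stable
  -- The cut lies strictly beyond |x|, so x is cut off as a point and no cylinder piece contains it.
  have h := (hγ α (N + x.length + 1) (hN.mono (by omega))).mul_right hT (ptElem θ d x w)
  have key : ∀ s ∈ pieces θ d (N + x.length + 1) α, s * ptElem θ d x w = 0 ∨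
      ∃ b, α.1.Maps x b ∧ s * ptElem θ d x w = ptElem θ d b w := by
    rintro s ⟨v, b, hvb, ⟨hv, rfl⟩ | ⟨hv, rfl⟩⟩
    · by_cases hvx : v = x
      · subst hvx
        exact Or.inr ⟨b, hvb, hd.pt_mul_pt _ _ _⟩
      · exact Or.inl (hd.pt_mul_pt_eq_zero hvx _ _)
    · exact Or.inl (hd.cyl_mul_pt_eq_zero (fun h => by have := h.length_le; omega) _ _)
  constructor
  · intro b hb
    refine hT.inverse.joinSet_eq_of_unique h ?_ (Or.inr ?_)
    · rintro _ ⟨s, hs, rfl⟩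
      refine (key s hs).imp_right ?_
      rintro ⟨b', hb', h⟩
      rwa [hb.right_unique hb']
    · exact ⟨_, ⟨x, b, hb, Or.inl ⟨by omega, rfl⟩⟩, hd.pt_mul_pt _ _ _⟩
  · intro hb
    refine hT.inverse.joinSet_eq_of_unique h ?_ (Or.inl rfl)
    rintro _ ⟨s, hs, rfl⟩
    refine (key s hs).imp_right ?_
    rintro ⟨b', hb', h⟩
    exact (hb ⟨b', hb'⟩).elim

theorem extension_map_mul (hT : IsDistributiveInverse T) (α β : CuntzToeplitz n) :
    γ (α * β) = γ α * γ β := by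
  obtain ⟨K, hK⟩ := α.exists_stable
  obtain ⟨M, hM⟩ := β.exists_stable
  -- β keeps every letter after the first M, so words of length at least M + K have images of length
  -- at least K, where α is stable.
  have hlen : ∀ {w x : List (Fin n)}, M + K ≤ w.length → β.1.Maps w x → K ≤ x.length := by
    intro w x hw hx
    rw [← List.take_append_drop M w, hM _ (by rw [List.length_take]; omega)] at hx
    obtain ⟨y, -, rfl⟩ := hx
    rw [List.length_append, List.length_drop]
    omega
  have hβ : Stable β.1 (M + K) := hM.mono (by omega)
  have hαβ : Stable (α * β).1 (M + K) := by
    intro w hw z u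
    constructor
    · intro h
      obtain ⟨v, hv, hu⟩ := CuntzToeplitz.maps_mul.1 h
      obtain ⟨x, hx, rfl⟩ := (hβ w hw z v).1 hv
      obtain ⟨y, hy, rfl⟩ := (hK x (hlen hw hx) z u).1 hu
      exact ⟨y, CuntzToeplitz.maps_mul.2 ⟨x, hx, hy⟩, rfl⟩
    · rintro ⟨y, h, rfl⟩
      obtain ⟨x, hx, hy⟩ := CuntzToeplitz.maps_mul.1 h
      exact CuntzToeplitz.maps_mul.2 ⟨x ++ z, (hβ w hw z _).2 ⟨x, hx, rfl⟩,
        (hK x (hlen hw hx) z _).2 ⟨y, hy, rfl⟩⟩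
  -- γ(α) is distributed over the pieces of β; the products are the pieces of αβ at the same cut,
  -- and zeros where the image under β leaves the domain of α.
  refine hT.inverse.joinSet_eq ((hγ _ _ hαβ).isJoinSet hT.inverse)
    ((hγ _ _ hβ).mul_left hT (γ α)) ?_ ?_
  · rintro s ⟨w, b, hwb, h⟩
    obtain ⟨x, hx, hb⟩ := CuntzToeplitz.maps_mul.1 hwb
    right
    rcases h with ⟨hw, rfl⟩ | ⟨hw, rfl⟩
    · exact ⟨_, ⟨w, x, hx, Or.inl ⟨hw, rfl⟩⟩, (hd.extension_mul_pt hγ hT α x w).1 b hb⟩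
    · exact ⟨_, ⟨w, x, hx, Or.inr ⟨hw, rfl⟩⟩,
        (hd.extension_mul_cyl hγ hT hK (hlen hw.ge hx) w).1 b hb⟩
  · rintro _ ⟨s, ⟨w, x, hx, h⟩, rfl⟩
    by_cases hb : ∃ b, α.1.Maps x b
    · obtain ⟨b, hb⟩ := hb
      refine Or.inr ⟨w, b, CuntzToeplitz.maps_mul.2 ⟨x, hx, hb⟩, ?_⟩
      rcases h with ⟨hw, rfl⟩ | ⟨hw, rfl⟩
      · exact Or.inl ⟨hw, (hd.extension_mul_pt hγ hT α x w).1 b hb⟩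
      · exact Or.inr ⟨hw, (hd.extension_mul_cyl hγ hT hK (hlen hw.ge hx) w).1 b hb⟩
    · left
      rcases h with ⟨hw, rfl⟩ | ⟨hw, rfl⟩
      · exact (hd.extension_mul_pt hγ hT α x w).2 hb
      · exact (hd.extension_mul_cyl hγ hT hK (hlen hw.ge hx) w).2 hb

omit hd in
theorem extension_zero (hT : IsDistributiveInverse T) : γ 0 = 0 := by
  obtain ⟨N, hN⟩ := (0 : CuntzToeplitz n).exists_stable
  refine hT.inverse.joinSet_eq_of_unique ((hγ _ _ hN).isJoinSet hT.inverse) ?_ (Or.inl rfl)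
  rintro s ⟨x, y, h, -⟩
  exact (CuntzToeplitz.not_maps_zero h).elim

/-- A compatible join is a union of graphs, so at a common cut its pieces are the union of the two
sets of pieces. -/
theorem isJoinMorphism_extension (hT : IsDistributiveInverse T) : IsJoinMorphism γ where
  map_mul := hd.extension_map_mul hγ hT
  map_zero := extension_zero hγ hT
  map_join α β δ hc h := by
    obtain ⟨N, hN⟩ := α.exists_stable
    obtain ⟨M, hM⟩ := β.exists_stable
    obtain ⟨L, hL⟩ := δ.exists_stable
    have hm := CuntzToeplitz.maps_of_isJoin hc h
    refine hT.inverse.isJoin_of_union ((hγ α (N + M + L) (hN.mono (by omega))).isJoinSet hT.inverse)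
      ((hγ β (N + M + L) (hM.mono (by omega))).isJoinSet hT.inverse) ?_
    convert (hγ δ (N + M + L) (hL.mono (by omega))).isJoinSet hT.inverse using 1
    ext t
    simp only [pieces, Set.mem_union, Set.mem_ofPred_eq, hm, or_and_right, exists_or]

/-- Cut at length |y|, the map yA* → xA* is a single cylinder piece. -/
theorem extension_toCT (hT : IsDistributiveInverse T) (s : Polycyclic n) :
    γ (toCT n s) = θ s := by
  rcases eq_zero_or_eq_word_mul s with rfl | ⟨x, y, rfl⟩
  · rw [map_zero, hd.map_zero, extension_zero hγ hT]
  · rw [toCT_word_mul]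
    refine hT.inverse.joinSet_eq_of_unique ((hγ _ _ (CuntzToeplitz.stable_cyl x y)).isJoinSet hT.inverse) ?_ (Or.inr ?_)
    · rintro s ⟨u, v, huv, h⟩
      obtain ⟨z, rfl, rfl⟩ := CuntzToeplitz.maps_cyl.1 huv
      rcases h with ⟨h, rfl⟩ | ⟨h, rfl⟩
      · simp at h
      · obtain rfl : z = [] := by simpa using h
        right
        simp [cylElem]
    · exact ⟨y, x, CuntzToeplitz.maps_cyl.2 ⟨[], by simp⟩, Or.inr ⟨rfl, rfl⟩⟩

end IsComplemented

end Extension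


open Polycyclic

/-! ### Uniqueness of the extension, and the universal property -/

namespace CuntzToeplitz

variable {n : ℕ}

theorem isZeroHom_toCT : IsZeroHom (toCT n) := ⟨map_mul _, map_zero _⟩

theorem maps_one_iff {x y : List (Fin n)} :
    (1 : CuntzToeplitz n).1.Maps x y ↔
      (pt [] []).1.Maps x y ∨ ∃ i, (toCT n (gen i * genInv i)).1.Maps x y := by
  have hi : ∀ i : Fin n, toCT n (gen i * genInv i) = cyl [i] [i] := fun i => by
    have := toCT_word_mul [i] [i]
    simpa [word, wordInv] using this
  simp only [maps_one, maps_pt, hi, maps_cyl]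
  constructor
  · rintro rfl
    cases x with
    | nil => simp
    | cons i x => exact Or.inr ⟨i, x, rfl, rfl⟩
  · rintro (⟨rfl, rfl⟩ | ⟨i, z, rfl, rfl⟩) <;> rfl

theorem isComplemented_pt : IsComplemented (toCT n) (pt [] []) where
  toIsZeroHom := isZeroHom_toCT
  idem := ext_maps fun x y => by simp [maps_mul, maps_pt]
  one_mul := by rw [map_one, one_mul]
  mul_gen i := ext_maps fun x y => by
    rw [toCT_gen]
    simp [maps_mul, maps_pt, maps_cyl, not_maps_zero]
  genInv_mul i := ext_maps fun x y => by
    rw [toCT_genInv]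
    simp [maps_mul, maps_pt, maps_cyl, not_maps_zero]
  join := by
    have hi : ∀ s ∈ insert (pt [] []) (Set.range fun i : Fin n => toCT n (gen i * genInv i)),
        IsIdempotentElem s := by
      intro s hs
      refine isIdempotentElem_iff.2 fun x y h => maps_one.1 (maps_one_iff.2 ?_)
      rcases hs with rfl | ⟨i, rfl⟩
      · exact Or.inl h
      · exact Or.inr ⟨i, h⟩
    refine isDistributiveInverse.compatJoin_of_isJoinSet ((Set.finite_range _).insert _)
      (fun s hs t ht => isInverseSemigroup.compatible_of_idem (hi s hs) (hi t ht))
      (isJoinSet_of_maps fun x y => ?_)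
    rw [map_one, maps_one_iff]
    simp

theorem ptElem_toCT (x y : List (Fin n)) : ptElem (toCT n) (pt [] []) x y = pt x y := by
  rw [ptElem, toCT_word, toCT_wordInv]
  exact ext_maps fun u v => by simp [maps_mul, maps_cyl, maps_pt]

theorem cylElem_toCT (x y : List (Fin n)) : cylElem (toCT n) x y = cyl x y := toCT_word_mul x y

/-- A permissible bijection is the join of its pieces. -/
theorem compatJoin_pieces {α : CuntzToeplitz n} {N : ℕ} (hα : Stable α.1 N) :
    CompatJoin (pieces (toCT n) (pt [] []) N α) α := by
  refine isDistributiveInverse.compatJoin_of_isJoinSet (pieces_finite _ _ _ _)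
    (isComplemented_pt.compatible_pieces isInverseSemigroup hα) (isJoinSet_of_maps fun u v => ?_)
  constructor
  · intro h
    rcases lt_or_ge u.length N with hu | hu
    · exact ⟨_, ⟨u, v, h, Or.inl ⟨hu, rfl⟩⟩, by rw [ptElem_toCT, maps_pt]; simp⟩
    · have hl : (u.take N).length = N := by simpa using hu
      have h' := h
      rw [← List.take_append_drop N u, hα _ hl.ge] at h'
      obtain ⟨y, hy, rfl⟩ := h'
      refine ⟨_, ⟨u.take N, y, hy, Or.inr ⟨hl, rfl⟩⟩, ?_⟩
      rw [cylElem_toCT, maps_cyl]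
      exact ⟨u.drop N, (List.take_append_drop N u).symm, rfl⟩
  · rintro ⟨s, ⟨x, y, h, ⟨hx, rfl⟩ | ⟨hx, rfl⟩⟩, hm⟩
    · rw [ptElem_toCT, maps_pt] at hm
      obtain ⟨rfl, rfl⟩ := hm
      exact h
    · rw [cylElem_toCT, maps_cyl] at hm
      obtain ⟨z, rfl, rfl⟩ := hm
      exact (hα x hx.ge z _).2 ⟨y, h, rfl⟩

section Uniqueness

variable {T : Type*} [SemigroupWithZero T]

/-- With p the idempotent `pt [] []`, expand γ'(1) in γ(p) = γ(p)γ'(1) by the join that gives 1. The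
terms γ(p)γ'(aᵢaᵢ⁻¹) = γ(paᵢaᵢ⁻¹) vanish, leaving γ(p)γ'(p); symmetrically γ'(p) = γ(1)γ'(p) gives
the same product. -/
theorem morphism_pt_eq (hT : IsDistributiveInverse T) {γ γ' : CuntzToeplitz n → T}
    (hγ : IsJoinMorphism γ) (hγ' : IsJoinMorphism γ')
    (h : ∀ s, γ (toCT n s) = γ' (toCT n s)) : γ (pt [] []) = γ' (pt [] []) := by
  have hD := isComplemented_pt (n := n)
  have hi : ∀ i : Fin n, pt [] [] * toCT n (gen i * genInv i) = 0 := fun i => by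
    rw [map_mul, ← mul_assoc, hD.mul_gen, zero_mul]
  have hi' : ∀ i : Fin n, toCT n (gen i * genInv i) * pt [] [] = 0 := fun i => by
    rw [map_mul, mul_assoc, hD.genInv_mul, mul_zero]
  have h1 : γ (pt [] []) = γ (pt [] []) * γ' (pt [] []) := by
    have hj := (hD.join.map hγ').mul_left hT (γ (pt [] []))
    rw [← h, ← hγ.map_mul, map_one, mul_one] at hj
    refine hT.inverse.joinSet_eq_of_unique hj ?_
      (Or.inr ⟨_, ⟨_, Set.mem_insert _ _, rfl⟩, rfl⟩)
    rintro _ ⟨_, ⟨_, rfl | ⟨i, rfl⟩, rfl⟩, rfl⟩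
    · exact Or.inr rfl
    · left
      change γ _ * γ' _ = 0
      rw [← h, ← hγ.map_mul, hi, hγ.map_zero]
  have h2 : γ' (pt [] []) = γ (pt [] []) * γ' (pt [] []) := by
    have hj := (hD.join.map hγ).mul_right hT (γ' (pt [] []))
    rw [h, ← hγ'.map_mul, map_one, one_mul] at hj
    refine hT.inverse.joinSet_eq_of_unique hj ?_
      (Or.inr ⟨_, ⟨_, Set.mem_insert _ _, rfl⟩, rfl⟩)
    rintro _ ⟨_, ⟨_, rfl | ⟨i, rfl⟩, rfl⟩, rfl⟩
    · exact Or.inr rfl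
    · left
      change γ _ * γ' _ = 0
      rw [h, ← hγ'.map_mul, hi', hγ'.map_zero]
  exact h1.trans h2.symm

/-- Every α is a finite compatible join of pieces, and each piece is either in the image of Pₙ or of
the form xpy⁻¹, where `morphism_pt_eq` applies. -/
theorem morphism_ext (hT : IsDistributiveInverse T) {γ γ' : CuntzToeplitz n → T}
    (hγ : IsJoinMorphism γ) (hγ' : IsJoinMorphism γ')
    (h : ∀ s, γ (toCT n s) = γ' (toCT n s)) : γ = γ' := by
  funext α
  obtain ⟨N, hN⟩ := α.exists_stable
  have hF : ∀ s ∈ pieces (toCT n) (pt [] []) N α, γ s = γ' s := by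
    rintro s ⟨x, y, -, ⟨-, rfl⟩ | ⟨-, rfl⟩⟩
    · rw [ptElem, hγ.map_mul, hγ.map_mul, hγ'.map_mul, hγ'.map_mul, h, h,
        morphism_pt_eq hT hγ hγ' h]
    · exact h _
  have h1 := (compatJoin_pieces hN).map hγ
  rw [Set.image_congr hF] at h1
  exact hT.inverse.joinSet_unique (h1.isJoinSet hT.inverse)
    (((compatJoin_pieces hN).map hγ').isJoinSet hT.inverse)

end Uniqueness

/-- `CT(A*)` is the Booleanization of `Pₙ`. -/
theorem isBooleanization_toCT : IsBooleanization.{0, 0, w} (toCT n) where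
  inverse := Polycyclic.isInverseSemigroup
  boolean := isBooleanInverse
  hom := isZeroHom_toCT
  injective := toCT_injective
  universal T _ hT θ hθ := by
    obtain ⟨d, hd⟩ := hT.exists_isComplemented hθ
    obtain ⟨γ, hγ⟩ := hd.exists_extension hT.toIsDistributiveInverse
    refine ⟨γ, ⟨hd.isJoinMorphism_extension hγ hT.toIsDistributiveInverse,
      hd.extension_toCT hγ hT.toIsDistributiveInverse⟩, ?_⟩
    rintro γ' ⟨hγ', h⟩
    exact morphism_ext hT.toIsDistributiveInverse hγ' (hd.isJoinMorphism_extension hγ hT.toIsDistributiveInverse)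
      fun s => (h s).trans (hd.extension_toCT hγ hT.toIsDistributiveInverse s).symm

end CuntzToeplitz

end InvSemi

/-- The Cuntz–Toeplitz monoid `CT(A*)`, `A = {a₁, …, aₙ}`, `n ≥ 2`, is the Booleanization of the
polycyclic monoid `Pₙ`, by way of the monoid embedding that sends the generator `aᵢ` to the map
`x ↦ aᵢx` on `A*` and `aᵢ⁻¹` to the inverse partial bijection `aᵢx ↦ x`. -/
theorem mainTheorem3 (n : ℕ) (hn : 2 ≤ n) :
    ∃ β : InvSemi.Polycyclic n →*₀ InvSemi.CuntzToeplitz n,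
      (∀ (i : Fin n) (x y : List (Fin n)),
        (β (InvSemi.Polycyclic.gen i)).1.Maps x y ↔ y = i :: x) ∧
      (∀ (i : Fin n) (x y : List (Fin n)),
        (β (InvSemi.Polycyclic.genInv i)).1.Maps x y ↔ x = i :: y) ∧
      InvSemi.IsBooleanization.{0, 0, w} β := by
  refine ⟨InvSemi.Polycyclic.toCT n, fun i x y => ?_, fun i x y => ?_,
    InvSemi.CuntzToeplitz.isBooleanization_toCT⟩
  · rw [InvSemi.Polycyclic.toCT_gen, InvSemi.CuntzToeplitz.maps_cyl]
    simp
  · rw [InvSemi.Polycyclic.toCT_genInv, InvSemi.CuntzToeplitz.maps_cyl]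
    simp
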